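/- Let $N,d,r$ be integers with $1\le r\le N$ and $r\le d$. For complex numbers $q$, $\sigma_1,\dots,\sigma_N$, $g_0,\dots,g_d$ put $$C(z)=z^N+\sum_{k=1}^N(-1)^k\sigma_k z^{N-k},\qquad W'(z)=\sum_{k=0}^d g_kz^k .$$ Let $\mathscr N_r\subset\mathbb C^{1+N}$ be the Zariski closure of the set of points $(q,\sigma)$ with $q\neq0$ for which there are polynomials $M_{N-r},Y_{2r}$ of degrees $N-r$ and $2r$ with $$C(z)^2-4q=M_{N-r}(z)^2\,Y_{2r}(z).\qquad(\mathrm I)$$ Let $\mathscr M_r\subset\mathbb C^{1+N+(d+1)}$ be the Zariski closure of the set of points $(q,\sigma,g)$ with $q\ne0$ and $g_d\neq0$ for which there are polynomials $M_{N-r},Y_{2r}$ as in $(\mathrm I)$, a polynomial $N_{d-r}$ of degree $d-r$ and a polynomial $D_{d-1}$ of degree at most $d-1$ such that, with the same $Y_{2r}$, $$W'(z)^2-D_{d-1}(z)=N_{d-r}(z)^2\,Y_{2r}(z).\qquad(\mathrm{II})$$ Let $\pi(q,\sigma,g)=(q,\sigma)$, and let $\mathbb C(V)$ denote the field of rational functions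 on an irreducible affine variety $V$. Theorem (intrinsic nature of the Galois group). Let $\mathscr M_{|r,\varphi)}$ be an irreducible component of $\mathscr M_r$ (a phase of rank $r$), let $\hat{\mathscr M}_{|r,\varphi)}$ be its intersection with the linear subspace $g_r=1$, $g_{r+1}=\dots=g_d=0$, and put $\mathscr N_{|r,\varphi)}=\pi(\hat{\mathscr M}_{|r,\varphi)})$. Then $\mathscr N_{|r,\varphi)}$ is an irreducible component of $\mathscr N_r$, the projection $\pi$ induces an embedding of fields $\pi^*:\mathbb C(\mathscr N_{|r,\varphi)})\hookrightarrow\mathbb C(\mathscr M_{|r,\varphi)})$, and the Galois group of $C$ viewed as a polynomial with coefficients in $\mathbb C(\mathscr M_{|r,\varphi)})$ is the same as the Galois group of $C$ viewed as a polynomial with coefficients in $\mathbb C(\mathscr N_{|r,\varphi)})$: there is an embedding over $\pi^*$ of the splitting field of $C$ over $\mathbb C(\mathscr N_{|r,\varphi)})$ into the splitting field of $C$ over $\mathbb C(\mathscr M_{|r,\varphi)})$ such that restriction along it is an isomorphism of the Galois groups (so both are the same group of permutations of the roots of $C$). -/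

import Mathlib

open MvPolynomial (zeroLocus vanishingIdeal)

noncomputable section

namespace GaugePhase

/-- The Zariski closure of a set of points of a complex affine space. -/
def zariskiClosure {ι : Type} (S : Set (ι → ℂ)) : Set (ι → ℂ) :=
  zeroLocus ℂ (vanishingIdeal ℂ S)

/-- An irreducible Zariski closed subset of the complex affine space with coordinates
indexed by `ι`. -/
structure AffineVariety (ι : Type) where
  /-- the set of points -/
  carrier : Set (ι → ℂ)
  isClosed : zariskiClosure carrier = carrier
  isPrime : (vanishingIdeal ℂ carrier).IsPrime

namespace AffineVariety

variable {ι : Type}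

/-- `V` is an irreducible component of `X`: a maximal irreducible closed subset of `X`. -/
def IsComponentOf (V : AffineVariety ι) (X : Set (ι → ℂ)) : Prop :=
  V.carrier ⊆ X ∧
    ∀ W : AffineVariety ι, V.carrier ⊆ W.carrier → W.carrier ⊆ X → W.carrier = V.carrier

/-- The coordinate ring `ℂ[V]`. -/
abbrev CoordinateRing (V : AffineVariety ι) : Type :=
  MvPolynomial ι ℂ ⧸ vanishingIdeal ℂ V.carrier

instance (V : AffineVariety ι) : IsDomain V.CoordinateRing :=
  have := V.isPrime
  Ideal.Quotient.isDomain _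

/-- The field `ℂ(V)` of rational functions. -/
abbrev FunctionField (V : AffineVariety ι) : Type :=
  FractionRing V.CoordinateRing

/-- The `i`-th coordinate function, as a rational function on `V`. -/
def coord (V : AffineVariety ι) (i : ι) : V.FunctionField :=
  algebraMap V.CoordinateRing V.FunctionField
    (Ideal.Quotient.mk (vanishingIdeal ℂ V.carrier) (MvPolynomial.X i))

end AffineVariety

/-- Coordinates `(q, σ₁, …, σ_N)`: `Sum.inl ()` is `q`, and `Sum.inr k` is `σ_{k+1}`. -/
abbrev SWCoord (N : ℕ) : Type := Unit ⊕ Fin N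

/-- Coordinates `(q, σ₁, …, σ_N, g₀, …, g_d)`: `Sum.inl i` are the coordinates `q, σ₁, …, σ_N`,
and `Sum.inr k` is `g_k`. -/
abbrev ChiralCoord (N d : ℕ) : Type := SWCoord N ⊕ Fin (d + 1)

/-- The characteristic polynomial `C(z) = z^N + ∑_{k=1}^N (-1)^k σ_k z^{N-k}`, where
`s k` stands for `σ_{k+1}`. -/
def charPoly {R : Type} [CommRing R] {N : ℕ} (s : Fin N → R) : Polynomial R :=
  Polynomial.X ^ N +
    ∑ k : Fin N, Polynomial.C ((-1) ^ (k.val + 1) * s k) * Polynomial.X ^ (N - (k.val + 1))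

/-- The derivative of the tree-level superpotential, `W'(z) = ∑_{k=0}^d g_k z^k`. -/
def superpotential' {d : ℕ} (g : Fin (d + 1) → ℂ) : Polynomial ℂ :=
  ∑ k : Fin (d + 1), Polynomial.C (g k) * Polynomial.X ^ k.val

/-- The factorization condition `C(z)² - 4q = M_{N-r}(z)² Y_{2r}(z)`. -/
def SWFactorization (N r : ℕ) (q : ℂ) (s : Fin N → ℂ) (M Y : Polynomial ℂ) : Prop :=
  M.natDegree = N - r ∧ Y.natDegree = 2 * r ∧
    charPoly s ^ 2 - Polynomial.C (4 * q) = M ^ 2 * Y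

/-- The factorization condition `W'(z)² - D_{d-1}(z) = N_{d-r}(z)² Y_{2r}(z)`, with `D_{d-1}` of
degree at most `d - 1`. -/
def SuperpotentialFactorization (d r : ℕ) (g : Fin (d + 1) → ℂ) (P D Y : Polynomial ℂ) : Prop :=
  P.natDegree = d - r ∧ D.degree < d ∧ superpotential' g ^ 2 - D = P ^ 2 * Y

/-- The variety `𝒩_r`: the Zariski closure of the set of `(q, σ)` with `q ≠ 0` for which
`C² - 4q` factorizes as `M² Y`. -/
def swVariety (N r : ℕ) : Set (SWCoord N → ℂ) :=
  zariskiClosure {x | x (Sum.inl ()) ≠ 0 ∧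
    ∃ M Y : Polynomial ℂ, SWFactorization N r (x (Sum.inl ())) (fun k => x (Sum.inr k)) M Y}

/-- The variety `ℳ_r`, the part of rank `r` of the chiral variety: the Zariski closure of the set
of `(q, σ, g)` with `q ≠ 0` and `g_d ≠ 0` for which both factorization conditions hold, with the
same `Y`. -/
def chiralVariety (N d r : ℕ) : Set (ChiralCoord N d → ℂ) :=
  zariskiClosure {x | x (Sum.inl (Sum.inl ())) ≠ 0 ∧ x (Sum.inr (Fin.last d)) ≠ 0 ∧
    ∃ M Y P D : Polynomial ℂ,
      SWFactorization N r (x (Sum.inl (Sum.inl ()))) (fun k => x (Sum.inl (Sum.inr k))) M Y ∧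
      SuperpotentialFactorization d r (fun k => x (Sum.inr k)) P D Y}

/-- The linear subspace `g_r = 1`, `g_{r+1} = … = g_d = 0`. -/
def slice (N d r : ℕ) : Set (ChiralCoord N d → ℂ) :=
  {x | ∀ k : Fin (d + 1),
    (k.val = r → x (Sum.inr k) = 1) ∧ (r < k.val → x (Sum.inr k) = 0)}

/-- The projection `π (q, σ, g) = (q, σ)`. -/
def projection {N d : ℕ} (x : ChiralCoord N d → ℂ) : SWCoord N → ℂ :=
  fun i => x (Sum.inl i)

/-- Along the field embedding `φ : K → L`, the polynomials `P` over `K` and `Q` over `L` have the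
same Galois group, as groups of permutations of the roots: for some embedding `j` over `φ` of the
splitting field of `P` into that of `Q`, restriction along `j` is an isomorphism of Galois
groups. -/
def SameGaloisGroup {K L : Type} [Field K] [Field L] (φ : K →+* L)
    (P : Polynomial K) (Q : Polynomial L) : Prop :=
  ∃ j : P.SplittingField →+* Q.SplittingField,
    (∀ a : K, j (algebraMap K P.SplittingField a) = algebraMap L Q.SplittingField (φ a)) ∧
    ∃ e : Q.Gal ≃* P.Gal, ∀ (τ : Q.Gal) (x : P.SplittingField), τ (j x) = j (e τ x)

end GaugePhase

end

/-! For fixed `Y`, condition (II) leaves the leading couplings free and determines the others. It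
says that `W'² - P²Y` has degree less than `d`. If the sign of `P` is chosen so that `W' + P√Y` has
leading term `2 g_d z^d`, then `W' - P√Y` has only negative powers of `z`, so `W'` is the polynomial
part of `P√Y` at infinity. Conversely, `g_r, …, g_d` may be prescribed arbitrarily; they determine
`P`, and then `g_0, …, g_{r-1}` (`couplings_eq_self`, `isSuperpotentialPair_couplings`). So the
generic point of a component of `ℳ_r` is a factorization `(q, σ, M, Y)` together with independent
couplings (`SWData.exists_generic`).

The crux is that `Y` is square-free at such a generic point (`SWData.squarefree_Y`). With `A = C(z)`
and `q ≠ 0` fixed, the linearization of `A² - 4q = M²Y` is surjective (`exists_solution`), so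
deformations are unobstructed, and there is a formal arc along which `A` moves to first order in the
direction `M G`, `G = gcd(M, Y)` (`exists_arc`). At a generic point the multiplicities of the roots
of `A² - 4q` cannot drop along the arc: at a root of multiplicity `e` the first-order variation `2 A
M G` vanishes to order at least `e - 1`. A root of multiplicity `m` in `M` and at least `2` in `Y`
would have `e ≥ 2m + 2`, while `A` does not vanish there and `M G`, a divisor of `M²`, vanishes to
order at most `2m`.

Let `V` be the closure of the image of the generic point under `π`. Square-freeness makes `M` and
`Y` the essentially unique square and square-free parts of `C² - 4q`, hence defined over `ℂ(V)`.
Their coefficients are integral over `ℂ[V]`, so every point of `V` carries a specialized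
factorization, and the couplings can be specialized to the slice: `V` is exactly the projection of
the slice. Minimality of the prime of the component, applied to data that specialize to the generic
one, shows that `V` is a component of `𝒩_r`. Finally `ℂ(ℳ)` embeds over `ℂ(V)` into the purely
transcendental field `ℂ(V)(t_0, …, t_d)`, so `ℂ(V)` is algebraically closed in it, and such an
extension does not change Galois groups (`sameGaloisGroup_map`). -/

noncomputable section

namespace GaugePhase

open Polynomial
open scoped PowerSeries

/-! ### Irreducible components and minimal primes -/

section Components

variable {ι : Type}

/-- The irreducible variety cut out by a prime ideal. -/
def AffineVariety.ofPrime [Finite ι] (P : Ideal (MvPolynomial ι ℂ)) [P.IsPrime] :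
    AffineVariety ι where
  carrier := zeroLocus ℂ P
  isClosed := by
    rw [zariskiClosure, MvPolynomial.IsPrime.vanishingIdeal_zeroLocus]
  isPrime := by
    rw [MvPolynomial.IsPrime.vanishingIdeal_zeroLocus]; infer_instance

theorem AffineVariety.isComponentOf_zariskiClosure_iff [Finite ι] (V : AffineVariety ι)
    (S : Set (ι → ℂ)) :
    V.IsComponentOf (zariskiClosure S) ↔
      vanishingIdeal ℂ V.carrier ∈ (vanishingIdeal ℂ S).minimalPrimes := by
  have key (W : AffineVariety ι) :
      W.carrier ⊆ zariskiClosure S ↔ vanishingIdeal ℂ S ≤ vanishingIdeal ℂ W.carrier :=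
    MvPolynomial.le_zeroLocus_iff_le_vanishingIdeal
  constructor
  · rintro ⟨h₁, h₂⟩
    refine ⟨⟨V.isPrime, (key V).1 h₁⟩, ?_⟩
    rintro Q ⟨hQ, hSQ⟩ hQV
    have hI : vanishingIdeal ℂ (AffineVariety.ofPrime Q).carrier = Q :=
      MvPolynomial.IsPrime.vanishingIdeal_zeroLocus Q
    have hW : (AffineVariety.ofPrime Q).carrier = V.carrier := by
      refine h₂ _ ?_ ((key _).2 (hI.symm ▸ hSQ))
      exact MvPolynomial.le_zeroLocus_iff_le_vanishingIdeal.2 hQV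
    rw [← hW, hI]
  · rintro ⟨⟨_, h₁⟩, h₂⟩
    refine ⟨(key V).2 h₁, fun W hVW hW ↦ ?_⟩
    have h := h₂ ⟨W.isPrime, (key W).1 hW⟩ (MvPolynomial.vanishingIdeal_anti_mono hVW)
    refine Set.Subset.antisymm ?_ hVW
    rw [← V.isClosed]
    exact MvPolynomial.le_zeroLocus_iff_le_vanishingIdeal.2 h

end Components

/-! ### Points with values in algebras -/

section Points

theorem exists_algHom_of_finiteType (k B : Type*) [Field k] [IsAlgClosed k] [CommRing B]
    [Algebra k B] [Algebra.FiniteType k B] [Nontrivial B] : Nonempty (B →ₐ[k] k) := by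
  obtain ⟨m, hm⟩ := Ideal.exists_maximal B
  let _ : Field (B ⧸ m) := Ideal.Quotient.field m
  have : Module.Finite k (B ⧸ m) := finite_of_finite_type_of_isJacobsonRing k (B ⧸ m)
  exact ⟨(IsAlgClosed.lift : (B ⧸ m) →ₐ[k] k).comp (Ideal.Quotient.mkₐ k m)⟩

/-- If `h` did not vanish at `x`, the Nullstellensatz would give a complex point of `A` where both
`u` and `h(x)` are nonzero, although its image lies in `S`. The finitely generated `A` is needed
because `R` itself may have no complex points. -/
theorem aeval_eq_zero_of_mem_vanishingIdeal {ι R : Type*} [CommRing R] [IsDomain R] [Algebra ℂ R]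
    {S : Set (ι → ℂ)} {A : Subalgebra ℂ R} (hA : A.FG) (x : ι → A) (u : A) (hu : u ≠ 0)
    (H : ∀ θ : A →ₐ[ℂ] ℂ, θ u ≠ 0 → (fun i ↦ θ (x i)) ∈ S)
    {h : MvPolynomial ι ℂ} (hh : h ∈ vanishingIdeal ℂ S) :
    MvPolynomial.aeval (fun i ↦ (x i : R)) h = 0 := by
  by_contra hne
  have hv : MvPolynomial.aeval x h ≠ 0 := by
    intro h0
    apply hne
    have := MvPolynomial.aeval_algebraMap_apply R x h
    rw [h0, map_zero] at this
    exact this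
  have hv' : u * MvPolynomial.aeval x h ≠ 0 := mul_ne_zero hu hv
  set v := u * MvPolynomial.aeval x h with hvdef
  have : Algebra.FiniteType ℂ A := (Subalgebra.fg_iff_finiteType A).1 hA
  have : Algebra.FiniteType A (Localization.Away v) :=
    IsLocalization.finiteType_of_monoid_fg (Submonoid.powers v) _
  have : Algebra.FiniteType ℂ (Localization.Away v) := Algebra.FiniteType.trans ‹_› ‹_›
  have : Nontrivial (Localization.Away v) :=
    (IsLocalization.injective (Localization.Away v)
      (powers_le_nonZeroDivisors_of_noZeroDivisors hv')).nontrivial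
  obtain ⟨η⟩ := exists_algHom_of_finiteType ℂ (Localization.Away v)
  let θ : A →ₐ[ℂ] ℂ := η.comp (IsScalarTower.toAlgHom ℂ A (Localization.Away v))
  have hθv : θ v ≠ 0 :=
    ((IsLocalization.Away.algebraMap_isUnit (S := Localization.Away v) v).map η).ne_zero
  rw [hvdef, map_mul] at hθv
  have hx := H θ (left_ne_zero_of_mul hθv)
  apply right_ne_zero_of_mul hθv
  have := hh _ hx
  rwa [← MvPolynomial.comp_aeval_apply] at this

/-- A minimal prime of the ideal of a set `S` is the kernel of evaluation at a point with
coordinates in a domain over the ring of all functions on `S`. -/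
theorem exists_prime_functions_of_mem_minimalPrimes {ι : Type*} {S : Set (ι → ℂ)}
    {P : Ideal (MvPolynomial ι ℂ)} (hP : P ∈ (vanishingIdeal ℂ S).minimalPrimes) :
    ∃ Q : Ideal (S → ℂ), Q.IsPrime ∧
      Q.comap (MvPolynomial.aeval (fun i (x : S) ↦ x.1 i) :
        MvPolynomial ι ℂ →ₐ[ℂ] (S → ℂ)).toRingHom = P := by
  have hI : vanishingIdeal ℂ S = (⊥ : Ideal (S → ℂ)).comap
      (MvPolynomial.aeval (fun i (x : S) ↦ x.1 i) : MvPolynomial ι ℂ →ₐ[ℂ] (S → ℂ)).toRingHom := by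
    ext h
    have (x : S) : (MvPolynomial.aeval (fun i (x : S) ↦ x.1 i) h : S → ℂ) x =
        MvPolynomial.aeval x.1 h :=
      MvPolynomial.comp_aeval_apply (φ := Pi.evalAlgHom ℂ (fun _ : S ↦ ℂ) x) _ h
    simp [funext_iff, this]
  rw [hI] at hP
  -- A minimal prime over a contracted ideal is itself the contraction of a prime.
  obtain ⟨Q, hQ, -, h⟩ := Ideal.exists_comap_eq_of_mem_minimalPrimes _ P hP
  exact ⟨Q, hQ, h⟩

/-- A homomorphism to an algebraically closed field extends along an integral extension. -/
theorem exists_extension_of_isIntegral {R S Ω : Type*} [CommRing R] [CommRing S] [Algebra R S]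
    [Algebra.IsIntegral R S] [Field Ω] [IsAlgClosed Ω] (θ : R →+* Ω)
    (hker : RingHom.ker (algebraMap R S) ≤ RingHom.ker θ) : ∃ η : S →+* Ω, η.comp (algebraMap R S) = θ := by
  have hprime : (RingHom.ker θ).IsPrime := RingHom.ker_isPrime θ
  obtain ⟨Q, -, hQ, hQc⟩ := Ideal.exists_ideal_over_prime_of_isIntegral (S := S)
    (RingHom.ker θ) ⊥ hker
  have : Q.LiesOver (RingHom.ker θ) := ⟨hQc.symm⟩
  let _ : Algebra (R ⧸ RingHom.ker θ) Ω := (RingHom.kerLift θ).toAlgebra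
  have h₁ : Function.Injective (algebraMap (R ⧸ RingHom.ker θ) Ω) := RingHom.kerLift_injective θ
  have h₂ : Function.Injective (algebraMap (R ⧸ RingHom.ker θ) (S ⧸ Q)) :=
    FaithfulSMul.algebraMap_injective _ _
  have : Algebra.IsIntegral (R ⧸ RingHom.ker θ) (S ⧸ Q) := inferInstance
  have : Module.IsTorsionFree (R ⧸ RingHom.ker θ) Ω :=
    Module.isTorsionFree_iff_algebraMap_injective.2 h₁
  have : Module.IsTorsionFree (R ⧸ RingHom.ker θ) (S ⧸ Q) :=
    Module.isTorsionFree_iff_algebraMap_injective.2 h₂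
  let l : (S ⧸ Q) →ₐ[R ⧸ RingHom.ker θ] Ω := IsAlgClosed.lift
  refine ⟨l.toRingHom.comp (Ideal.Quotient.mk Q), ?_⟩
  ext x
  have := l.commutes (Ideal.Quotient.mk _ x)
  exact this

end Points

/-! ### The factorization conditions over a general ring -/

section Factorization

variable {R R' : Type} [CommRing R] [CommRing R'] {N d r : ℕ}

theorem map_charPoly (θ : R →+* R') (s : Fin N → R) :
    (charPoly s).map θ = charPoly fun k ↦ θ (s k) := by
  simp [charPoly, Polynomial.map_sum]

theorem degree_charPoly_sub_X_pow_lt [Nontrivial R] (s : Fin N → R) :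
    (∑ k : Fin N, C ((-1) ^ (k.val + 1) * s k) * X ^ (N - (k.val + 1))).degree <
      (N : WithBot ℕ) := by
  refine (degree_sum_le _ _).trans_lt ((Finset.sup_lt_iff (WithBot.bot_lt_coe N)).2 fun k _ ↦ ?_)
  refine (degree_C_mul_X_pow_le _ _).trans_lt ?_
  have h : N - (k.val + 1) < N := Nat.sub_lt (Fin.pos k) (Nat.succ_pos _)
  exact WithBot.coe_lt_coe.2 (by simpa using h)

theorem monic_charPoly [Nontrivial R] (s : Fin N → R) : (charPoly s).Monic :=
  monic_X_pow_add (degree_charPoly_sub_X_pow_lt s)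

theorem natDegree_charPoly [Nontrivial R] (s : Fin N → R) : (charPoly s).natDegree = N := by
  rw [charPoly, natDegree_add_eq_left_of_degree_lt, natDegree_X_pow]
  rw [degree_X_pow]
  exact degree_charPoly_sub_X_pow_lt s

theorem exists_charPoly_eq {p : R[X]} (hp : p.Monic) (hN : p.natDegree = N) :
    ∃ s : Fin N → R, charPoly s = p := by
  refine ⟨fun k ↦ (-1) ^ (k.val + 1) * p.coeff (N - (k.val + 1)), ?_⟩
  have h : ∀ k : Fin N, (-1 : R) ^ (k.val + 1) * ((-1) ^ (k.val + 1) * p.coeff (N - (k.val + 1)))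
      = p.coeff (N - (k.val + 1)) := fun k ↦ by
    rw [← mul_assoc, ← mul_pow]; simp
  conv_rhs => rw [hp.as_sum, hN]
  simp only [charPoly, h]
  rw [← Fin.sum_univ_eq_sum_range fun i ↦ C (p.coeff i) * X ^ i]
  congr 1
  refine Fintype.sum_equiv Fin.revPerm _ _ fun k ↦ ?_
  simp [Fin.val_rev]

theorem charPoly_injective : Function.Injective (charPoly : (Fin N → R) → R[X]) := by
  intro s s' h
  funext k
  have hc (s : Fin N → R) : (charPoly s).coeff (N - (k.val + 1)) =
      (X ^ N : R[X]).coeff (N - (k.val + 1)) + (-1) ^ (k.val + 1) * s k := by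
    rw [charPoly, coeff_add, finsetSum_coeff]
    congr 1
    rw [Finset.sum_eq_single k]
    · rw [coeff_C_mul, coeff_X_pow_self, mul_one]
    · intro j _ hj
      have hjk : N - (k.val + 1) ≠ N - (j.val + 1) := by
        have := Fin.val_ne_of_ne hj
        omega
      rw [coeff_C_mul, coeff_X_pow, if_neg hjk, mul_zero]
    · simp
  have hk := congrArg (fun p ↦ p.coeff (N - (k.val + 1))) h
  simp only [hc, add_right_inj] at hk
  have h1 : ((-1 : R) ^ (k.val + 1)) * (-1) ^ (k.val + 1) = 1 := by rw [← mul_pow]; simp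
  linear_combination ((-1) ^ (k.val + 1)) * hk - (s k - s' k) * h1

/-- The polynomial `∑ g_k z^k` over a general ring. -/
def superpotential (g : Fin (d + 1) → R) : R[X] :=
  ∑ k : Fin (d + 1), C (g k) * X ^ k.val

theorem map_superpotential (θ : R →+* R') (g : Fin (d + 1) → R) :
    (superpotential g).map θ = superpotential fun k ↦ θ (g k) := by
  simp [superpotential, Polynomial.map_sum]

theorem coeff_superpotential (g : Fin (d + 1) → R) (k : Fin (d + 1)) :
    (superpotential g).coeff k = g k := by
  simp only [superpotential, finsetSum_coeff, coeff_C_mul, coeff_X_pow]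
  rw [Finset.sum_eq_single k] <;> simp +contextual [Fin.ext_iff, eq_comm]

theorem natDegree_superpotential_le (g : Fin (d + 1) → R) :
    (superpotential g).natDegree ≤ d := by
  refine natDegree_sum_le_of_forall_le _ _ fun k _ ↦ ?_
  exact (natDegree_C_mul_X_pow_le _ _).trans (Nat.lt_succ_iff.1 k.2)

/-- Monic polynomials `M`, `Y` of degrees `N - r` and `2 r` with `C² - 4 q = M² Y`. -/
structure IsSWPair (r : ℕ) (q : R) (s : Fin N → R) (M Y : R[X]) : Prop where
  monic_left : M.Monic
  natDegree_left : M.natDegree = N - r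
  monic_right : Y.Monic
  natDegree_right : Y.natDegree = 2 * r
  eq : charPoly s ^ 2 - C (4 * q) = M ^ 2 * Y

/-- Polynomials `P` and `D` with `W'² - D = P² Y`, of degrees at most `d - r` and less
than `d`. -/
structure IsSuperpotentialPair (r : ℕ) (g : Fin (d + 1) → R) (P D Y : R[X]) : Prop where
  natDegree_le : P.natDegree ≤ d - r
  degree_lt : D.degree < d
  eq : superpotential g ^ 2 - D = P ^ 2 * Y

theorem IsSWPair.map [Nontrivial R'] {q : R} {s : Fin N → R} {M Y : R[X]}
    (h : IsSWPair r q s M Y) (θ : R →+* R') :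
    IsSWPair r (θ q) (fun k ↦ θ (s k)) (M.map θ) (Y.map θ) where
  monic_left := h.monic_left.map θ
  natDegree_left := by rw [h.monic_left.natDegree_map, h.natDegree_left]
  monic_right := h.monic_right.map θ
  natDegree_right := by rw [h.monic_right.natDegree_map, h.natDegree_right]
  eq := by
    have := congrArg (Polynomial.map θ) h.eq
    simpa [map_charPoly, map_ofNat] using this

theorem IsSWPair.of_map {θ : R →+* R'} (hθ : Function.Injective θ) {q : R} {s : Fin N → R}
    {M Y : R[X]} (h : IsSWPair r (θ q) (fun k ↦ θ (s k)) (M.map θ) (Y.map θ)) :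
    IsSWPair r q s M Y where
  monic_left := monic_of_injective hθ h.monic_left
  natDegree_left := by rw [← natDegree_map_eq_of_injective hθ, h.natDegree_left]
  monic_right := monic_of_injective hθ h.monic_right
  natDegree_right := by rw [← natDegree_map_eq_of_injective hθ, h.natDegree_right]
  eq := map_injective θ hθ (by simpa [map_charPoly, map_ofNat] using h.eq)

theorem IsSuperpotentialPair.map {g : Fin (d + 1) → R} {P D Y : R[X]}
    (h : IsSuperpotentialPair r g P D Y) (θ : R →+* R') :
    IsSuperpotentialPair r (fun k ↦ θ (g k)) (P.map θ) (D.map θ) (Y.map θ) where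
  natDegree_le := natDegree_map_le.trans h.natDegree_le
  degree_lt := degree_map_le.trans_lt h.degree_lt
  eq := by
    have := congrArg (Polynomial.map θ) h.eq
    simpa [map_superpotential] using this

theorem IsSuperpotentialPair.of_map {θ : R →+* R'} (hθ : Function.Injective θ)
    {g : Fin (d + 1) → R} {P D Y : R[X]}
    (h : IsSuperpotentialPair r (fun k ↦ θ (g k)) (P.map θ) (D.map θ) (Y.map θ)) :
    IsSuperpotentialPair r g P D Y where
  natDegree_le := by rw [← natDegree_map_eq_of_injective hθ]; exact h.natDegree_le
  degree_lt := by rw [← degree_map_eq_of_injective hθ]; exact h.degree_lt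
  eq := map_injective θ hθ (by simpa [map_superpotential] using h.eq)

/-- The coefficient of `z^{2d}` in the second factorization condition. -/
theorem IsSuperpotentialPair.sq_eq {g : Fin (d + 1) → R} {P D Y : R[X]}
    (h : IsSuperpotentialPair r g P D Y) (hrd : r ≤ d) (hY : Y.Monic)
    (hYr : Y.natDegree = 2 * r) : g (Fin.last d) ^ 2 = P.coeff (d - r) ^ 2 := by
  have e := congrArg (fun p ↦ p.coeff (2 * d)) h.eq
  have h₁ : (superpotential g ^ 2).coeff (2 * d) = g (Fin.last d) ^ 2 := by
    have := coeff_pow_of_natDegree_le (natDegree_superpotential_le g) (m := 2)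
    rw [this]
    congr 1
    exact coeff_superpotential g (Fin.last d)
  have h₂ : D.coeff (2 * d) = 0 := by
    refine coeff_eq_zero_of_degree_lt (h.degree_lt.trans_le ?_)
    exact_mod_cast (by omega : d ≤ 2 * d)
  have h₃ : (P ^ 2 * Y).coeff (2 * d) = P.coeff (d - r) ^ 2 := by
    have hd : 2 * d = 2 * (d - r) + 2 * r := by omega
    rw [hd, coeff_mul_add_eq_of_natDegree_le (natDegree_pow_le_of_le 2 h.natDegree_le) hYr.le,
      coeff_pow_of_natDegree_le h.natDegree_le, ← hYr, hY.coeff_natDegree, mul_one]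
  simpa [h₁, h₂, h₃] using e

end Factorization

/-! ### The two sets of solutions, with normalized factors -/

section Sets

variable (N d r : ℕ)

/-- The points `(q, σ)`, `q ≠ 0`, for which `C² - 4q` factorizes. -/
def swSet : Set (SWCoord N → ℂ) :=
  {x | x (Sum.inl ()) ≠ 0 ∧
    ∃ M Y : Polynomial ℂ, SWFactorization N r (x (Sum.inl ())) (fun k => x (Sum.inr k)) M Y}

/-- The points `(q, σ, g)`, `q ≠ 0` and `g_d ≠ 0`, for which both factorizations hold. -/
def chiralSet : Set (ChiralCoord N d → ℂ) :=
  {x | x (Sum.inl (Sum.inl ())) ≠ 0 ∧ x (Sum.inr (Fin.last d)) ≠ 0 ∧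
    ∃ M Y P D : Polynomial ℂ,
      SWFactorization N r (x (Sum.inl (Sum.inl ()))) (fun k => x (Sum.inl (Sum.inr k))) M Y ∧
      SuperpotentialFactorization d r (fun k => x (Sum.inr k)) P D Y}

variable {N d r}

/-- The left side of the factorization is monic of degree `2N > 0`, so dividing `M` by its leading
coefficient `c` makes `c² Y` monic. The scalar is kept because the cofactor in (II) has to be
rescaled with the same `Y`. -/
theorem SWFactorization.exists_isSWPair (hrN : r ≤ N) (hr : 1 ≤ r) {q : ℂ} {s : Fin N → ℂ}
    {M Y : ℂ[X]} (h : SWFactorization N r q s M Y) :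
    ∃ c : ℂ, c ≠ 0 ∧ IsSWPair r q s (C c⁻¹ * M) (C (c ^ 2) * Y) := by
  obtain ⟨hM, hY, e⟩ := h
  have hY0 : Y ≠ 0 := by rintro rfl; simp at hY; omega
  have hf : (charPoly s ^ 2 - C (4 * q)).Monic := by
    refine ((monic_charPoly s).pow 2).sub_of_left (degree_C_le.trans_lt ?_)
    rw [degree_eq_natDegree ((monic_charPoly s).pow 2).ne_zero,
      (monic_charPoly s).natDegree_pow, natDegree_charPoly]
    exact_mod_cast (by omega : 0 < 2 * N)
  have hM0 : M ≠ 0 := by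
    rintro rfl
    rw [e] at hf
    simpa using hf.ne_zero
  have hc : M.leadingCoeff ≠ 0 := leadingCoeff_ne_zero.2 hM0
  have hl : M.leadingCoeff ^ 2 * Y.leadingCoeff = 1 := by
    rw [e, Monic, leadingCoeff_mul, leadingCoeff_pow] at hf
    exact hf
  refine ⟨M.leadingCoeff, hc, ?_, ?_, ?_, ?_, ?_⟩
  · rw [Monic, leadingCoeff_mul, leadingCoeff_C, inv_mul_cancel₀ hc]
  · rw [natDegree_C_mul (inv_ne_zero hc), hM]
  · rw [Monic, leadingCoeff_mul, leadingCoeff_C, hl]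
  · rw [natDegree_C_mul (pow_ne_zero 2 hc), hY]
  · have : C M.leadingCoeff⁻¹ ^ 2 * C (M.leadingCoeff ^ 2) = 1 := by
      rw [← C_pow, ← C_mul, ← mul_pow, inv_mul_cancel₀ hc]; simp
    rw [e, mul_pow]
    linear_combination (-M ^ 2 * Y) * this

theorem mem_swSet_iff (hrN : r ≤ N) (hr : 1 ≤ r) {x : SWCoord N → ℂ} :
    x ∈ swSet N r ↔ x (Sum.inl ()) ≠ 0 ∧
      ∃ M Y, IsSWPair r (x (Sum.inl ())) (fun k ↦ x (Sum.inr k)) M Y := by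
  refine and_congr_right fun _ ↦ ⟨?_, ?_⟩
  · rintro ⟨M, Y, h⟩
    obtain ⟨c, -, h⟩ := h.exists_isSWPair hrN hr
    exact ⟨_, _, h⟩
  · rintro ⟨M, Y, h⟩
    exact ⟨M, Y, h.natDegree_left, h.natDegree_right, h.eq⟩

theorem mem_chiralSet_iff (hrN : r ≤ N) (hr : 1 ≤ r) (hrd : r ≤ d) {x : ChiralCoord N d → ℂ} :
    x ∈ chiralSet N d r ↔ x (Sum.inl (Sum.inl ())) ≠ 0 ∧ x (Sum.inr (Fin.last d)) ≠ 0 ∧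
      ∃ M Y P D, IsSWPair r (x (Sum.inl (Sum.inl ()))) (fun k ↦ x (Sum.inl (Sum.inr k))) M Y ∧
        IsSuperpotentialPair r (fun k ↦ x (Sum.inr k)) P D Y := by
  refine and_congr_right fun _ ↦ and_congr_right fun hg ↦ ⟨?_, ?_⟩
  · rintro ⟨M, Y, P, D, h, hP, hD, e⟩
    obtain ⟨c, hc, h⟩ := h.exists_isSWPair hrN hr
    refine ⟨_, _, C c⁻¹ * P, D, h, (natDegree_C_mul_le _ _).trans hP.le, hD, ?_⟩
    have : C c⁻¹ ^ 2 * C (c ^ 2) = 1 := by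
      rw [← C_pow, ← C_mul, ← mul_pow, inv_mul_cancel₀ hc]; simp
    change superpotential _ ^ 2 - D = _ at e
    rw [e, mul_pow]
    linear_combination (-P ^ 2 * Y) * this
  · rintro ⟨M, Y, P, D, h, h'⟩
    refine ⟨M, Y, P, D, ⟨h.natDegree_left, h.natDegree_right, h.eq⟩, ?_, h'.degree_lt, h'.eq⟩
    -- The square of the coefficient of `P` in degree `d - r` is `g_d²`, so `g_d ≠ 0` restores the
    -- exact degree.
    refine natDegree_eq_of_le_of_coeff_ne_zero h'.natDegree_le fun h0 ↦ hg ?_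
    simpa [h0] using h'.sq_eq hrd h.monic_right h.natDegree_right

end Sets

/-! ### Solutions with values in a domain satisfy the equations of the closures -/

section Transfer

variable {R : Type} [CommRing R] [Algebra ℂ R] {N d r : ℕ}

theorem exists_fg_subalgebra (T : Set R) (hT : T.Finite) (ps : Finset R[X]) :
    ∃ A : Subalgebra ℂ R, A.FG ∧ T ⊆ A ∧ ∀ p ∈ ps, ∃ p' : A[X], p'.map (algebraMap A R) = p := by
  classical
  let T' : Set R := T ∪ ps.biUnion coeffs
  refine ⟨Algebra.adjoin ℂ T', ?_, ?_, fun p hp ↦ ?_⟩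
  · exact ⟨(hT.union (Finset.finite_toSet (ps.biUnion coeffs))).toFinset, by rw [Set.Finite.coe_toFinset]⟩
  · exact Set.subset_union_left.trans Algebra.subset_adjoin
  · refine (mem_lifts _).1 ((lifts_iff_coeff_lifts p).2 fun n ↦ ?_)
    have : p.coeff n ∈ Algebra.adjoin ℂ T' := by
      by_cases h : p.coeff n = 0
      · rw [h]; exact zero_mem _
      · refine Algebra.subset_adjoin (Or.inr ?_)
        simp only [Finset.coe_biUnion, Set.mem_iUnion]
        exact ⟨p, hp, by simpa using coeff_mem_coeffs h⟩
    exact ⟨⟨_, this⟩, rfl⟩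

theorem vanishingIdeal_swSet_le_ker [IsDomain R] (hrN : r ≤ N) (hr : 1 ≤ r) {x : SWCoord N → R}
    {M Y : R[X]} (hq : x (Sum.inl ()) ≠ 0)
    (h : IsSWPair r (x (Sum.inl ())) (fun k ↦ x (Sum.inr k)) M Y) :
    vanishingIdeal ℂ (swSet N r) ≤ RingHom.ker (MvPolynomial.aeval (R := ℂ) x) := by
  classical
  obtain ⟨A, hA, hx, hp⟩ := exists_fg_subalgebra (Set.range x) (Set.finite_range x) {M, Y}
  obtain ⟨M, rfl⟩ := hp M (by simp)
  obtain ⟨Y, rfl⟩ := hp Y (by simp)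
  intro p hp
  let x' : SWCoord N → A := fun i ↦ ⟨x i, hx ⟨i, rfl⟩⟩
  refine aeval_eq_zero_of_mem_vanishingIdeal hA x' (x' (Sum.inl ())) ?_ ?_ hp
  · intro h0; exact hq (congrArg Subtype.val h0)
  · intro θ hθ
    have h' : IsSWPair r (x' (Sum.inl ())) (fun k ↦ x' (Sum.inr k)) M Y :=
      IsSWPair.of_map (θ := algebraMap A R) Subtype.val_injective h
    exact (mem_swSet_iff hrN hr).2 ⟨hθ, _, _, h'.map θ.toRingHom⟩

theorem vanishingIdeal_chiralSet_le_ker [IsDomain R] (hrN : r ≤ N) (hr : 1 ≤ r) (hrd : r ≤ d)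
    {x : ChiralCoord N d → R} {M Y P D : R[X]} (hq : x (Sum.inl (Sum.inl ())) ≠ 0)
    (hg : x (Sum.inr (Fin.last d)) ≠ 0)
    (h : IsSWPair r (x (Sum.inl (Sum.inl ()))) (fun k ↦ x (Sum.inl (Sum.inr k))) M Y)
    (h' : IsSuperpotentialPair r (fun k ↦ x (Sum.inr k)) P D Y) :
    vanishingIdeal ℂ (chiralSet N d r) ≤ RingHom.ker (MvPolynomial.aeval (R := ℂ) x) := by
  classical
  obtain ⟨A, hA, hx, hp⟩ := exists_fg_subalgebra (Set.range x) (Set.finite_range x) {M, Y, P, D}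
  obtain ⟨M, rfl⟩ := hp M (by simp)
  obtain ⟨Y, rfl⟩ := hp Y (by simp)
  obtain ⟨P, rfl⟩ := hp P (by simp)
  obtain ⟨D, rfl⟩ := hp D (by simp)
  intro p hp
  let x' : ChiralCoord N d → A := fun i ↦ ⟨x i, hx ⟨i, rfl⟩⟩
  refine aeval_eq_zero_of_mem_vanishingIdeal hA x'
    (x' (Sum.inl (Sum.inl ())) * x' (Sum.inr (Fin.last d))) ?_ ?_ hp
  · intro h0; exact mul_ne_zero hq hg (congrArg Subtype.val h0)
  · intro θ hθ
    rw [map_mul] at hθ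
    have h₁ : IsSWPair r (x' (Sum.inl (Sum.inl ()))) (fun k ↦ x' (Sum.inl (Sum.inr k))) M Y :=
      IsSWPair.of_map (θ := algebraMap A R) Subtype.val_injective h
    have h₂ : IsSuperpotentialPair r (fun k ↦ x' (Sum.inr k)) P D Y :=
      IsSuperpotentialPair.of_map (θ := algebraMap A R) Subtype.val_injective h'
    exact (mem_chiralSet_iff hrN hr hrd).2 ⟨left_ne_zero_of_mul hθ, right_ne_zero_of_mul hθ,
      _, _, _, _, h₁.map θ.toRingHom, h₂.map θ.toRingHom⟩

end Transfer

/-! ### Generic points of the components -/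

section Generic

variable {N d r : ℕ}

/-- A family of polynomials of bounded degree is a polynomial over the ring of functions. -/
theorem exists_polynomial_functions {S : Type} {k : Type} [CommRing k] (p : S → k[X]) (B : ℕ)
    (hB : ∀ x, (p x).natDegree ≤ B) :
    ∃ p' : (S → k)[X], ∀ x, p'.map (Pi.evalRingHom (fun _ ↦ k) x) = p x := by
  refine ⟨∑ i ∈ Finset.range (B + 1), C (fun x ↦ (p x).coeff i) * X ^ i, fun x ↦ ?_⟩
  rw [Polynomial.map_sum]
  conv_rhs => rw [(p x).as_sum_range_C_mul_X_pow' (Nat.lt_succ_of_le (hB x))]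
  simp

theorem ext_functions {S : Type} {k : Type} [CommRing k] {p p' : (S → k)[X]}
    (h : ∀ x, p.map (Pi.evalRingHom (fun _ ↦ k) x) = p'.map (Pi.evalRingHom (fun _ ↦ k) x)) :
    p = p' := by
  ext n x
  simpa using congrArg (fun p ↦ p.coeff n) (h x)

theorem natDegree_le_functions {S : Type} {k : Type} [CommRing k] {p : (S → k)[X]} {B : ℕ}
    (h : ∀ x, (p.map (Pi.evalRingHom (fun _ ↦ k) x)).natDegree ≤ B) : p.natDegree ≤ B := by
  refine natDegree_le_iff_coeff_eq_zero.2 fun n hn ↦ ?_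
  ext x
  simpa using natDegree_le_iff_coeff_eq_zero.1 (h x) n hn

theorem degree_lt_functions {S : Type} {k : Type} [CommRing k] {p : (S → k)[X]} {B : ℕ}
    (h : ∀ x, (p.map (Pi.evalRingHom (fun _ ↦ k) x)).degree < B) : p.degree < B := by
  refine (degree_lt_iff_coeff_zero _ _).2 fun n hn ↦ ?_
  ext x
  simpa using (degree_lt_iff_coeff_zero _ _).1 (h x) n hn

theorem monic_functions {S : Type} {k : Type} [CommRing k] {p : (S → k)[X]} {B : ℕ}
    (h : ∀ x, (p.map (Pi.evalRingHom (fun _ ↦ k) x)).Monic)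
    (hB : ∀ x, (p.map (Pi.evalRingHom (fun _ ↦ k) x)).natDegree = B) : p.Monic := by
  refine monic_of_natDegree_le_of_coeff_eq_one B (natDegree_le_functions fun x ↦ (hB x).le) ?_
  ext x
  have := (h x).coeff_natDegree
  rw [hB] at this
  simpa using this

theorem isSWPair_functions {S : Type} [Nonempty S] {k : Type} [CommRing k] [Nontrivial k]
    {q : S → k} {s : Fin N → S → k} {M Y : (S → k)[X]}
    (h : ∀ x, IsSWPair r (q x) (fun k ↦ s k x) (M.map (Pi.evalRingHom (fun _ ↦ k) x))
      (Y.map (Pi.evalRingHom (fun _ ↦ k) x))) : IsSWPair r q s M Y := by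
  have hM := monic_functions (fun x ↦ (h x).monic_left) fun x ↦ (h x).natDegree_left
  have hY := monic_functions (fun x ↦ (h x).monic_right) fun x ↦ (h x).natDegree_right
  have x₀ : S := Classical.arbitrary S
  refine ⟨hM, ?_, hY, ?_, ext_functions fun x ↦ ?_⟩
  · rw [← (h x₀).natDegree_left, hM.natDegree_map]
  · rw [← (h x₀).natDegree_right, hY.natDegree_map]
  · simpa [map_charPoly] using (h x).eq

theorem isSuperpotentialPair_functions {S : Type} {k : Type} [CommRing k]
    {g : Fin (d + 1) → S → k} {P D Y : (S → k)[X]}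
    (h : ∀ x, IsSuperpotentialPair r (fun k ↦ g k x) (P.map (Pi.evalRingHom (fun _ ↦ k) x))
      (D.map (Pi.evalRingHom (fun _ ↦ k) x)) (Y.map (Pi.evalRingHom (fun _ ↦ k) x))) :
    IsSuperpotentialPair r g P D Y := by
  refine ⟨natDegree_le_functions fun x ↦ (h x).natDegree_le,
    degree_lt_functions fun x ↦ (h x).degree_lt, ext_functions fun x ↦ ?_⟩
  simpa [map_superpotential] using (h x).eq

/-- The generic point of a component of the Seiberg-Witten variety. -/
theorem exists_generic_swPoint (hrN : r ≤ N) (hr : 1 ≤ r) {P : Ideal (MvPolynomial (SWCoord N) ℂ)}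
    (hP : P ∈ (vanishingIdeal ℂ (swSet N r)).minimalPrimes) :
    ∃ (F : Type) (_ : Field F) (_ : Algebra ℂ F) (x : SWCoord N → F) (M Y : F[X]),
      RingHom.ker (MvPolynomial.aeval (R := ℂ) x) = P ∧ x (Sum.inl ()) ≠ 0 ∧
      IsSWPair r (x (Sum.inl ())) (fun k ↦ x (Sum.inr k)) M Y := by
  obtain ⟨Q, hQ, hQP⟩ := exists_prime_functions_of_mem_minimalPrimes hP
  have hne : Nonempty (swSet N r) := by
    by_contra hne
    rw [not_nonempty_iff] at hne
    exact hQ.ne_top (Subsingleton.elim _ _)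
  have H (x : swSet N r) := (mem_swSet_iff hrN hr).1 x.2
  -- The factors are chosen point by point, without any regularity: every such choice has
  -- coefficients in the ring of all functions on the set.
  choose hq M Y h using H
  obtain ⟨M', hM'⟩ := exists_polynomial_functions M _ fun x ↦ (h x).natDegree_left.le
  obtain ⟨Y', hY'⟩ := exists_polynomial_functions Y _ fun x ↦ (h x).natDegree_right.le
  let F := FractionRing ((swSet N r → ℂ) ⧸ Q)
  let χ : (swSet N r → ℂ) →ₐ[ℂ] F :=
    (IsScalarTower.toAlgHom ℂ ((swSet N r → ℂ) ⧸ Q) F).comp (Ideal.Quotient.mkₐ ℂ Q)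
  have hχ (a) : χ a = 0 ↔ a ∈ Q := by
    rw [← Ideal.Quotient.eq_zero_iff_mem]
    exact IsFractionRing.to_map_eq_zero_iff (R := (swSet N r → ℂ) ⧸ Q) (K := F)
  let x : SWCoord N → swSet N r → ℂ := fun i y ↦ y.1 i
  have hpair : IsSWPair r (x (Sum.inl ())) (fun k ↦ x (Sum.inr k)) M' Y' :=
    isSWPair_functions fun y ↦ by rw [hM', hY']; exact h y
  refine ⟨F, inferInstance, inferInstance, fun i ↦ χ (x i), _, _, ?_, ?_, hpair.map χ.toRingHom⟩
  · rw [← hQP]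
    ext p
    rw [RingHom.mem_ker, ← MvPolynomial.comp_aeval_apply, hχ]
    rfl
  · refine (IsUnit.map χ (?_ : IsUnit (x (Sum.inl ())))).ne_zero
    exact Pi.isUnit_iff.2 fun y ↦ (hq y).isUnit

/-- The generic point of a component of the chiral variety. -/
theorem exists_generic_chiralPoint (hrN : r ≤ N) (hr : 1 ≤ r) (hrd : r ≤ d)
    {I : Ideal (MvPolynomial (ChiralCoord N d) ℂ)}
    (hI : I ∈ (vanishingIdeal ℂ (chiralSet N d r)).minimalPrimes) :
    ∃ (F : Type) (_ : Field F) (_ : Algebra ℂ F) (x : ChiralCoord N d → F) (M Y P D : F[X]),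
      RingHom.ker (MvPolynomial.aeval (R := ℂ) x) = I ∧ x (Sum.inl (Sum.inl ())) ≠ 0 ∧
      x (Sum.inr (Fin.last d)) ≠ 0 ∧
      IsSWPair r (x (Sum.inl (Sum.inl ()))) (fun k ↦ x (Sum.inl (Sum.inr k))) M Y ∧
      IsSuperpotentialPair r (fun k ↦ x (Sum.inr k)) P D Y := by
  obtain ⟨Q, hQ, hQP⟩ := exists_prime_functions_of_mem_minimalPrimes hI
  have hne : Nonempty (chiralSet N d r) := by
    by_contra hne
    rw [not_nonempty_iff] at hne
    exact hQ.ne_top (Subsingleton.elim _ _)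
  have H (x : chiralSet N d r) := (mem_chiralSet_iff hrN hr hrd).1 x.2
  choose hq hg M Y P D h h' using H
  obtain ⟨M', hM'⟩ := exists_polynomial_functions M _ fun x ↦ (h x).natDegree_left.le
  obtain ⟨Y', hY'⟩ := exists_polynomial_functions Y _ fun x ↦ (h x).natDegree_right.le
  obtain ⟨P', hP'⟩ := exists_polynomial_functions P _ fun x ↦ (h' x).natDegree_le
  obtain ⟨D', hD'⟩ := exists_polynomial_functions D d fun x ↦
    natDegree_le_of_degree_le (h' x).degree_lt.le
  let F := FractionRing ((chiralSet N d r → ℂ) ⧸ Q)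
  let χ : (chiralSet N d r → ℂ) →ₐ[ℂ] F :=
    (IsScalarTower.toAlgHom ℂ ((chiralSet N d r → ℂ) ⧸ Q) F).comp (Ideal.Quotient.mkₐ ℂ Q)
  have hχ (a) : χ a = 0 ↔ a ∈ Q := by
    rw [← Ideal.Quotient.eq_zero_iff_mem]
    exact IsFractionRing.to_map_eq_zero_iff (R := (chiralSet N d r → ℂ) ⧸ Q) (K := F)
  let x : ChiralCoord N d → chiralSet N d r → ℂ := fun i y ↦ y.1 i
  have hpair : IsSWPair r (x (Sum.inl (Sum.inl ()))) (fun k ↦ x (Sum.inl (Sum.inr k))) M' Y' :=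
    isSWPair_functions fun y ↦ by rw [hM', hY']; exact h y
  have hpair' : IsSuperpotentialPair r (fun k ↦ x (Sum.inr k)) P' D' Y' :=
    isSuperpotentialPair_functions fun y ↦ by rw [hP', hD', hY']; exact h' y
  refine ⟨F, inferInstance, inferInstance, fun i ↦ χ (x i), _, _, _, _, ?_, ?_, ?_,
    hpair.map χ.toRingHom, hpair'.map χ.toRingHom⟩
  · rw [← hQP]
    ext p
    rw [RingHom.mem_ker, ← MvPolynomial.comp_aeval_apply, hχ]
    rfl
  · refine (IsUnit.map χ (?_ : IsUnit (x (Sum.inl (Sum.inl ()))))).ne_zero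
    exact Pi.isUnit_iff.2 fun y ↦ (hq y).isUnit
  · refine (IsUnit.map χ (?_ : IsUnit (x (Sum.inr (Fin.last d))))).ne_zero
    exact Pi.isUnit_iff.2 fun y ↦ (hg y).isUnit

end Generic

/-! ### Square roots at infinity -/

section Sqrt

variable {R R' : Type} [CommRing R] [CommRing R'] {d r : ℕ}

/-- The root is the binomial series `(1 + X)^(1/2)` with `u - 1` substituted for `X`. -/
theorem exists_powerSeries_sqrt [Algebra ℂ R] {u : R⟦X⟧} (hu : PowerSeries.constantCoeff u = 1) :
    ∃ U : R⟦X⟧, U ^ 2 = u ∧ PowerSeries.constantCoeff U = 1 := by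
  let B : R⟦X⟧ := PowerSeries.binomialSeries R (1 / 2 : ℂ)
  have hB : B * B = 1 + PowerSeries.X := by
    rw [← PowerSeries.binomialSeries_add, add_halves]
    simpa using PowerSeries.binomialSeries_nat (R := ℂ) (A := R) 1
  have h0 : PowerSeries.constantCoeff (u - 1) = 0 := by simp [hu]
  have hs : PowerSeries.HasSubst (u - 1) := PowerSeries.HasSubst.of_constantCoeff_zero' h0
  let σ : R⟦X⟧ →ₐ[R] R⟦X⟧ := PowerSeries.substAlgHom hs
  have hX : σ PowerSeries.X = u - 1 := PowerSeries.substAlgHom_X hs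
  obtain ⟨B', hB'⟩ : PowerSeries.X ∣ B - 1 := by
    rw [PowerSeries.X_dvd_iff]
    simp [B]
  refine ⟨σ B, ?_, ?_⟩
  · rw [sq, ← map_mul, hB, map_add, map_one, hX]
    ring
  · have : σ B = 1 + (u - 1) * σ B' := by
      rw [← hX, ← map_mul, ← hB', map_sub, map_one]
      ring
    rw [this, map_add, map_mul, h0]
    simp

theorem powerSeries_sqrt_unique [IsDomain R] (h2 : (2 : R) ≠ 0) {U U' : R⟦X⟧} (h : U ^ 2 = U' ^ 2)
    (hU : PowerSeries.constantCoeff U = 1) (hU' : PowerSeries.constantCoeff U' = 1) : U = U' := by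
  rcases sq_eq_sq_iff_eq_or_eq_neg.1 h with h | h
  · exact h
  · have := congrArg PowerSeries.constantCoeff h
    rw [map_neg, hU, hU'] at this
    exact absurd (by linear_combination this) h2

/-- `U` is the square root of the reversal of `Y` with constant coefficient `1`, and `V` is the
inverse of `U`. -/
structure IsSqrtPair (r : ℕ) (Y : R[X]) (U V : R⟦X⟧) : Prop where
  sq_eq : U ^ 2 = (reflect (2 * r) Y).toPowerSeries
  mul_eq : U * V = 1
  constantCoeff_eq : PowerSeries.constantCoeff U = 1

theorem map_reflect (θ : R →+* R') (n : ℕ) (p : R[X]) :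
    (reflect n p).map θ = reflect n (p.map θ) := by
  ext i; simp [coeff_reflect]

theorem IsSqrtPair.map {Y : R[X]} {U V : R⟦X⟧} (h : IsSqrtPair r Y U V) (θ : R →+* R') :
    IsSqrtPair r (Y.map θ) (PowerSeries.map θ U) (PowerSeries.map θ V) where
  sq_eq := by
    rw [← map_pow, h.sq_eq, ← Polynomial.polynomial_map_coe, map_reflect]
  mul_eq := by rw [← map_mul, h.mul_eq, map_one]
  constantCoeff_eq := by
    rw [← PowerSeries.coeff_zero_eq_constantCoeff_apply, PowerSeries.coeff_map,
      PowerSeries.coeff_zero_eq_constantCoeff_apply, h.constantCoeff_eq, map_one]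

theorem exists_isSqrtPair [Algebra ℂ R] {Y : R[X]} (hY : Y.Monic) (hYr : Y.natDegree = 2 * r) :
    ∃ U V, IsSqrtPair r Y U V := by
  obtain ⟨U, hU, hU1⟩ := exists_powerSeries_sqrt (u := (reflect (2 * r) Y).toPowerSeries) (by
    rw [← PowerSeries.coeff_zero_eq_constantCoeff_apply, Polynomial.coeff_coe, coeff_reflect,
      revAt_le (Nat.zero_le _), Nat.sub_zero, ← hYr, hY.coeff_natDegree])
  exact ⟨U, PowerSeries.invOfUnit U 1, hU, PowerSeries.mul_invOfUnit U 1 hU1, hU1⟩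

theorem IsSqrtPair.unique [IsDomain R] (h2 : (2 : R) ≠ 0) {Y : R[X]} {U V U' V' : R⟦X⟧}
    (h : IsSqrtPair r Y U V) (h' : IsSqrtPair r Y U' V') : U = U' ∧ V = V' := by
  have hU : U = U' := powerSeries_sqrt_unique h2 (h.sq_eq.trans h'.sq_eq.symm)
    h.constantCoeff_eq h'.constantCoeff_eq
  refine ⟨hU, ?_⟩
  have h₁ := h.mul_eq
  have h₂ := h'.mul_eq
  subst hU
  linear_combination (-V) * h₂ + V' * h₁

/-- The reversal of the polynomial `P` of degree `d - r` with `P √Y` equal to `∑ t_k z^k` up to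
terms of degree less than `r`, where `V` is the reversal of `1 / √Y`. -/
def cofactorRev (r : ℕ) (V : R⟦X⟧) (t : Fin (d + 1) → R) : R[X] :=
  PowerSeries.trunc (d - r + 1) ((reflect d (superpotential t)).toPowerSeries * V)

/-- The coefficients of the polynomial part of `P √Y`, where the leading coefficients `t_k`,
`k ≥ r`, are prescribed. -/
def couplings (r : ℕ) (U V : R⟦X⟧) (t : Fin (d + 1) → R) : Fin (d + 1) → R :=
  fun k ↦ PowerSeries.coeff (d - k.val) ((cofactorRev r V t : R⟦X⟧) * U)

theorem map_cofactorRev (θ : R →+* R') (V : R⟦X⟧) (t : Fin (d + 1) → R) :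
    (cofactorRev r V t).map θ = cofactorRev r (PowerSeries.map θ V) fun k ↦ θ (t k) := by
  rw [cofactorRev, cofactorRev, ← PowerSeries.trunc_map, map_mul,
    ← Polynomial.polynomial_map_coe, map_reflect, map_superpotential]

theorem map_couplings (θ : R →+* R') (U V : R⟦X⟧) (t : Fin (d + 1) → R) (k : Fin (d + 1)) :
    θ (couplings r U V t k) =
      couplings r (PowerSeries.map θ U) (PowerSeries.map θ V) (fun k ↦ θ (t k)) k := by
  rw [couplings, couplings, ← PowerSeries.coeff_map, map_mul, ← Polynomial.polynomial_map_coe,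
    map_cofactorRev]

theorem X_pow_dvd_sub_trunc (n : ℕ) (φ : R⟦X⟧) :
    PowerSeries.X ^ n ∣ φ - (PowerSeries.trunc n φ).toPowerSeries := by
  rw [PowerSeries.X_pow_dvd_iff]
  intro m hm
  simp [PowerSeries.coeff_trunc, hm]

theorem coeff_eq_of_X_pow_dvd_sub {n m : ℕ} {φ ψ : R⟦X⟧} (h : PowerSeries.X ^ n ∣ φ - ψ)
    (hm : m < n) : PowerSeries.coeff m φ = PowerSeries.coeff m ψ := by
  have := PowerSeries.X_pow_dvd_iff.1 h m hm
  rwa [map_sub, sub_eq_zero] at this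

theorem coeff_reflect_superpotential (t : Fin (d + 1) → R) (k : Fin (d + 1)) :
    PowerSeries.coeff (d - k.val) (reflect d (superpotential t)).toPowerSeries = t k := by
  have hk : k.val ≤ d := Nat.lt_succ_iff.1 k.2
  rw [Polynomial.coeff_coe, coeff_reflect, revAt_le (Nat.sub_le _ _), Nat.sub_sub_self hk,
    coeff_superpotential]

/-- For `k ≥ r` only the terms of order at most `d - r` in `1/z` matter. The truncation keeps these,
and there multiplication by `U` undoes multiplication by `V`. -/
theorem couplings_of_le {U V : R⟦X⟧} (h : U * V = 1) (t : Fin (d + 1) → R) {k : Fin (d + 1)}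
    (hk : r ≤ k.val) : couplings r U V t k = t k := by
  rw [← coeff_reflect_superpotential t k, couplings]
  have hkd : k.val ≤ d := Nat.lt_succ_iff.1 k.2
  refine coeff_eq_of_X_pow_dvd_sub (n := d - r + 1) ?_ (by omega)
  obtain ⟨e, he⟩ := X_pow_dvd_sub_trunc (d - r + 1) ((reflect d (superpotential t)).toPowerSeries * V)
  refine ⟨-(e * U), ?_⟩
  rw [cofactorRev]
  linear_combination (-U) * he + ((reflect d (superpotential t)).toPowerSeries : R⟦X⟧) * h

theorem X_pow_dvd_reflect_superpotential_couplings (U V : R⟦X⟧) (t : Fin (d + 1) → R) :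
    PowerSeries.X ^ (d + 1) ∣ ((reflect d (superpotential (couplings r U V t))).toPowerSeries : R⟦X⟧) -
      (cofactorRev r V t : R⟦X⟧) * U := by
  rw [PowerSeries.X_pow_dvd_iff]
  intro m hm
  have := coeff_reflect_superpotential (couplings r U V t) ⟨d - m, by omega⟩
  simp only [couplings] at this
  rw [Nat.sub_sub_self (by omega)] at this
  rw [map_sub, sub_eq_zero, ← this]

theorem natDegree_cofactorRev_le (V : R⟦X⟧) (t : Fin (d + 1) → R) :
    (cofactorRev r V t).natDegree ≤ d - r :=
  Nat.lt_succ_iff.1 (PowerSeries.natDegree_trunc_lt _ _)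

theorem reflect_reflect (n : ℕ) (p : R[X]) : reflect n (reflect n p) = p := by
  ext i; simp

theorem reflect_factorization {W P Y : R[X]} (hrd : r ≤ d) (hW : W.natDegree ≤ d)
    (hP : P.natDegree ≤ d - r) (hY : Y.natDegree ≤ 2 * r) :
    reflect (2 * d) (W ^ 2 - P ^ 2 * Y) =
      reflect d W ^ 2 - reflect (d - r) P ^ 2 * reflect (2 * r) Y := by
  have h : 2 * d = ((d - r) + (d - r)) + 2 * r := by omega
  rw [reflect_sub, sq, two_mul, reflect_mul _ _ hW hW, ← two_mul, h, sq,
    reflect_mul _ _ (natDegree_mul_le.trans (add_le_add hP hP)) hY, reflect_mul _ _ hP hP]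
  ring

/-- By construction `W'` and `P√Y` agree, after reversal, modulo `X^(d+1)`; hence so do their
squares. For a reversal in degree `2d` this divisibility means that the difference of squares has
degree less than `d`. -/
theorem isSuperpotentialPair_couplings (hrd : r ≤ d) {Y : R[X]} (hY : Y.natDegree = 2 * r)
    {U V : R⟦X⟧} (h : IsSqrtPair r Y U V) (t : Fin (d + 1) → R) :
    ∃ P D, IsSuperpotentialPair r (couplings r U V t) P D Y := by
  set W := superpotential (couplings r U V t) with hW
  have hP : (reflect (d - r) (cofactorRev r V t)).natDegree ≤ d - r :=
    natDegree_reflect_le.trans (max_le le_rfl (natDegree_cofactorRev_le V t))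
  refine ⟨reflect (d - r) (cofactorRev r V t),
    W ^ 2 - reflect (d - r) (cofactorRev r V t) ^ 2 * Y, hP, ?_, by rw [sub_sub_cancel]⟩
  have hrefl := reflect_factorization hrd (natDegree_superpotential_le (couplings r U V t)) hP hY.le
  rw [reflect_reflect, ← hW] at hrefl
  have hdvd : PowerSeries.X ^ (d + 1) ∣
      ((reflect (2 * d) (W ^ 2 - reflect (d - r) (cofactorRev r V t) ^ 2 * Y)).toPowerSeries : R⟦X⟧) := by
    rw [hrefl, Polynomial.coe_sub, Polynomial.coe_mul, Polynomial.coe_pow, Polynomial.coe_pow,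
      ← h.sq_eq]
    obtain ⟨e, he⟩ := X_pow_dvd_reflect_superpotential_couplings (r := r) U V t
    rw [← hW] at he
    exact ⟨e * ((reflect d W).toPowerSeries + (cofactorRev r V t : R⟦X⟧) * U),
      by linear_combination ((reflect d W).toPowerSeries + (cofactorRev r V t : R⟦X⟧) * U) * he⟩
  refine (degree_lt_iff_coeff_zero _ _).2 fun n hn ↦ ?_
  by_cases hn2 : n ≤ 2 * d
  · have := PowerSeries.X_pow_dvd_iff.1 hdvd (2 * d - n) (by omega)
    rwa [Polynomial.coeff_coe, coeff_reflect, revAt_le (Nat.sub_le _ _),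
      Nat.sub_sub_self hn2] at this
  · refine coeff_eq_zero_of_natDegree_lt (lt_of_le_of_lt ?_ (not_le.1 hn2))
    refine (natDegree_sub_le _ _).trans (max_le ?_ ?_)
    · exact natDegree_pow_le_of_le 2 (natDegree_superpotential_le _)
    · refine natDegree_mul_le.trans ?_
      have := natDegree_pow_le_of_le 2 hP
      omega

/-- After reversal, `X^(d+1)` divides `(W - QU)(W + QU)`. The second factor has constant term `2 g_d
≠ 0` and `X` is prime, so `X^(d+1)` divides the first one. -/
theorem couplings_eq_self [IsDomain R] (h2 : (2 : R) ≠ 0) (hrd : r ≤ d) {Y : R[X]} (hY : Y.Monic)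
    (hYr : Y.natDegree = 2 * r) {U V : R⟦X⟧} (h : IsSqrtPair r Y U V) {g : Fin (d + 1) → R}
    {P D : R[X]} (hP : IsSuperpotentialPair r g P D Y) (hg : g (Fin.last d) ≠ 0) :
    couplings r U V g = g := by
  -- Only `P²` enters the condition, so the sign of `P` may be chosen to match `g_d`.
  wlog hsign : g (Fin.last d) = P.coeff (d - r) generalizing P
  · refine this (P := -P) ⟨?_, hP.degree_lt, ?_⟩ ?_
    · rw [natDegree_neg]; exact hP.natDegree_le
    · rw [hP.eq, neg_sq]
    · rcases sq_eq_sq_iff_eq_or_eq_neg.1 (hP.sq_eq hrd hY hYr) with h | h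
      · exact absurd h hsign
      · rw [h, coeff_neg]
  set W : R⟦X⟧ := (reflect d (superpotential g)).toPowerSeries with hW
  set Q := reflect (d - r) P with hQ
  have hQdeg : Q.natDegree ≤ d - r := natDegree_reflect_le.trans (max_le le_rfl hP.natDegree_le)
  have hdvd : PowerSeries.X ^ (d + 1) ∣ (W - Q.toPowerSeries * U) * (W + Q.toPowerSeries * U) := by
    have e : (W - Q.toPowerSeries * U) * (W + Q.toPowerSeries * U) = (reflect (2 * d) D).toPowerSeries := by
      have hD : D = superpotential g ^ 2 - P ^ 2 * Y := by rw [← hP.eq, sub_sub_cancel]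
      rw [hD, reflect_factorization hrd (natDegree_superpotential_le g) hP.natDegree_le hYr.le,
        Polynomial.coe_sub, Polynomial.coe_mul, Polynomial.coe_pow, Polynomial.coe_pow, ← h.sq_eq]
      ring
    rw [e, PowerSeries.X_pow_dvd_iff]
    intro m hm
    rw [Polynomial.coeff_coe, coeff_reflect, revAt_le (by omega)]
    refine coeff_eq_zero_of_degree_lt (hP.degree_lt.trans_le ?_)
    exact_mod_cast (by omega : d ≤ 2 * d - m)
  have hW0 : PowerSeries.constantCoeff W = g (Fin.last d) := by
    have := coeff_reflect_superpotential g (Fin.last d)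
    rwa [Fin.val_last, Nat.sub_self, PowerSeries.coeff_zero_eq_constantCoeff_apply] at this
  have hQ0 : PowerSeries.constantCoeff (Q : R⟦X⟧) = g (Fin.last d) := by
    rw [← PowerSeries.coeff_zero_eq_constantCoeff_apply, Polynomial.coeff_coe, coeff_reflect,
      revAt_le (Nat.zero_le _), Nat.sub_zero, hsign]
  have hnd : ¬ PowerSeries.X ∣ W + Q.toPowerSeries * U := by
    rw [PowerSeries.X_dvd_iff, map_add, map_mul, hW0, hQ0, h.constantCoeff_eq, mul_one, ← two_mul]
    exact mul_ne_zero h2 hg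
  obtain ⟨e, he⟩ := PowerSeries.X_prime.pow_dvd_of_dvd_mul_right _ hnd hdvd
  have hcof : cofactorRev r V g = Q := by
    have hXW : PowerSeries.X ^ (d - r + 1) ∣ W * V - Q.toPowerSeries := by
      have hle : d + 1 = (d - r + 1) + r := by omega
      exact ⟨PowerSeries.X ^ r * e * V, by
        rw [hle, pow_add] at he
        linear_combination V * he + (Q : R⟦X⟧) * h.mul_eq⟩
    ext m
    rw [cofactorRev, PowerSeries.coeff_trunc]
    split_ifs with hm
    · rw [coeff_eq_of_X_pow_dvd_sub hXW hm, Polynomial.coeff_coe]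
    · rw [coeff_eq_zero_of_natDegree_lt (by omega)]
  ext k
  rw [couplings, hcof, ← coeff_reflect_superpotential g k]
  exact (coeff_eq_of_X_pow_dvd_sub ⟨e, he⟩ (by omega)).symm

end Sqrt

/-! ### Points with a chosen factorization -/

/-- A point `(q, σ)` over `R` with a factorization `C² - 4q = M² Y` and the square root of `Y` at
infinity. -/
@[ext]
structure SWData (N r : ℕ) (R : Type) [CommRing R] where
  point : SWCoord N → R
  M : R[X]
  Y : R[X]
  U : R⟦X⟧
  V : R⟦X⟧
  pair : IsSWPair r (point (Sum.inl ())) (fun k ↦ point (Sum.inr k)) M Y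
  sqrt : IsSqrtPair r Y U V

namespace SWData

variable {N d r : ℕ} {R R' : Type} [CommRing R] [CommRing R']

/-- The value `q` at the given point. -/
abbrev q (D : SWData N r R) : R := D.point (Sum.inl ())

/-- The values `σ_k` at the given point. -/
abbrev s (D : SWData N r R) : Fin N → R := fun k ↦ D.point (Sum.inr k)

/-- Base change along a ring homomorphism. -/
@[simps]
def map [Nontrivial R'] (D : SWData N r R) (θ : R →+* R') : SWData N r R' where
  point i := θ (D.point i)
  M := D.M.map θ
  Y := D.Y.map θ
  U := PowerSeries.map θ D.U
  V := PowerSeries.map θ D.V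
  pair := D.pair.map θ
  sqrt := D.sqrt.map θ

theorem exists_of_pair [Algebra ℂ R] {x : SWCoord N → R} {M Y : R[X]}
    (h : IsSWPair r (x (Sum.inl ())) (fun k ↦ x (Sum.inr k)) M Y) :
    ∃ D : SWData N r R, D.point = x ∧ D.M = M ∧ D.Y = Y := by
  obtain ⟨U, V, hUV⟩ := exists_isSqrtPair h.monic_right h.natDegree_right
  exact ⟨⟨x, M, Y, U, V, h, hUV⟩, rfl, rfl, rfl⟩

theorem eq_of [IsDomain R] (h2 : (2 : R) ≠ 0) {D D' : SWData N r R} (h : D.point = D'.point)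
    (hM : D.M = D'.M) (hY : D.Y = D'.Y) : D = D' := by
  obtain ⟨hU, hV⟩ := D.sqrt.unique h2 (hY ▸ D'.sqrt)
  exact SWData.ext h hM hY hU hV

/-- The point of the chiral variety with leading couplings `t`. -/
def chiralPoint (D : SWData N r R) (t : Fin (d + 1) → R) : ChiralCoord N d → R :=
  Sum.elim D.point (couplings r D.U D.V t)

theorem map_chiralPoint [Nontrivial R'] (D : SWData N r R) (θ : R →+* R') (t : Fin (d + 1) → R)
    (i : ChiralCoord N d) :
    θ (D.chiralPoint t i) = (D.map θ).chiralPoint (fun k ↦ θ (t k)) i := by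
  rcases i with i | k
  · rfl
  · exact map_couplings θ _ _ _ k

section Ideal

variable [Algebra ℂ R] [Algebra ℂ R'] [Nontrivial R']

variable (d) in
/-- The point of the chiral variety whose leading couplings are indeterminates. -/
def genericPoint [Nontrivial R] (D : SWData N r R) : ChiralCoord N d → MvPolynomial (Fin (d + 1)) R :=
  (D.map MvPolynomial.C).chiralPoint MvPolynomial.X

variable (d) in
/-- The ideal of polynomials that vanish at the generic point. -/
def ideal [Nontrivial R] (D : SWData N r R) : Ideal (MvPolynomial (ChiralCoord N d) ℂ) :=
  RingHom.ker (MvPolynomial.aeval (R := ℂ) (D.genericPoint d))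

instance isPrime_ideal [IsDomain R] (D : SWData N r R) : (D.ideal d).IsPrime :=
  RingHom.ker_isPrime _

theorem algHom_genericPoint [Nontrivial R] (D : SWData N r R)
    (θ : MvPolynomial (Fin (d + 1)) R →ₐ[ℂ] R') (i : ChiralCoord N d) :
    θ (D.genericPoint d i) = (D.map ((θ : MvPolynomial (Fin (d + 1)) R →+* R').comp MvPolynomial.C)).chiralPoint
      (fun k ↦ θ (MvPolynomial.X k)) i := by
  have := map_chiralPoint (D.map MvPolynomial.C) (θ : MvPolynomial (Fin (d + 1)) R →+* R') MvPolynomial.X i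
  rw [genericPoint]
  refine this.trans (congrArg (fun E : SWData N r R' ↦ E.chiralPoint _ i) ?_)
  ext <;> simp

theorem aeval_eq_zero_of_mem_ideal [Nontrivial R] (D : SWData N r R)
    (θ : MvPolynomial (Fin (d + 1)) R →ₐ[ℂ] R') {h : MvPolynomial (ChiralCoord N d) ℂ}
    (hh : h ∈ D.ideal d) :
    MvPolynomial.aeval ((D.map ((θ : MvPolynomial (Fin (d + 1)) R →+* R').comp MvPolynomial.C)).chiralPoint
      (fun k ↦ θ (MvPolynomial.X k))) h = 0 := by
  have := congrArg θ (RingHom.mem_ker.1 hh)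
  rw [map_zero, MvPolynomial.comp_aeval_apply] at this
  rw [← this]
  congr 2
  ext i
  exact (D.algHom_genericPoint θ i).symm

theorem aeval_chiralPoint_eq_zero [Nontrivial R] (D : SWData N r R) (t : Fin (d + 1) → R)
    {h : MvPolynomial (ChiralCoord N d) ℂ} (hh : h ∈ D.ideal d) :
    MvPolynomial.aeval (D.chiralPoint t) h = 0 := by
  have := D.aeval_eq_zero_of_mem_ideal ((MvPolynomial.aeval t).restrictScalars ℂ) hh
  rw [← this]
  congr 2
  ext i
  congr 1
  · ext <;> simp
  · simp

theorem map_aeval_genericPoint [Nontrivial R] (D : SWData N r R) (θ : R →ₐ[ℂ] R')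
    (h : MvPolynomial (ChiralCoord N d) ℂ) :
    MvPolynomial.map (θ : R →+* R') (MvPolynomial.aeval (D.genericPoint d) h) =
      MvPolynomial.aeval ((D.map (θ : R →+* R')).genericPoint d) h := by
  have h₁ := MvPolynomial.comp_aeval_apply (R := ℂ) (D.genericPoint d)
    (φ := (MvPolynomial.mapAlgHom θ : MvPolynomial (Fin (d + 1)) R →ₐ[ℂ] _)) h
  refine h₁.trans ?_
  congr 2
  funext i
  rw [algHom_genericPoint, genericPoint]
  have e : ((D.map (θ : R →+* R')).map (MvPolynomial.C (σ := Fin (d + 1)))) =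
      D.map (((MvPolynomial.mapAlgHom θ : MvPolynomial (Fin (d + 1)) R →ₐ[ℂ] _) :
        MvPolynomial (Fin (d + 1)) R →+* MvPolynomial (Fin (d + 1)) R').comp MvPolynomial.C) := by
    ext <;> simp
  rw [e]
  simp

theorem ideal_le_map [Nontrivial R] (D : SWData N r R) (θ : R →ₐ[ℂ] R') :
    D.ideal d ≤ (D.map (θ : R →+* R')).ideal d := by
  intro h hh
  refine RingHom.mem_ker.2 ?_
  rw [← map_aeval_genericPoint, RingHom.mem_ker.1 hh, map_zero]

theorem ideal_map_le_of_injective [Nontrivial R] (D : SWData N r R) (θ : R →ₐ[ℂ] R')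
    (hθ : Function.Injective θ) : (D.map (θ : R →+* R')).ideal d ≤ D.ideal d := by
  intro h hh
  refine RingHom.mem_ker.2 (MvPolynomial.map_injective (θ : R →+* R') hθ ?_)
  rw [map_aeval_genericPoint, RingHom.mem_ker.1 hh, map_zero]

theorem rename_mem_ideal_iff [Nontrivial R] (D : SWData N r R) {h : MvPolynomial (SWCoord N) ℂ} :
    MvPolynomial.rename Sum.inl h ∈ D.ideal d ↔ MvPolynomial.aeval D.point h = 0 := by
  rw [ideal, RingHom.mem_ker, MvPolynomial.aeval_rename]
  have : MvPolynomial.aeval (D.genericPoint d ∘ Sum.inl) h =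
      MvPolynomial.C (MvPolynomial.aeval D.point h) :=
    (MvPolynomial.comp_aeval_apply (φ := IsScalarTower.toAlgHom ℂ R
      (MvPolynomial (Fin (d + 1)) R)) D.point h).symm
  rw [this, MvPolynomial.C_eq_zero]

theorem vanishingIdeal_le_ideal [IsDomain R] (hrN : r ≤ N) (hr : 1 ≤ r) (hrd : r ≤ d)
    (D : SWData N r R) (hq : D.q ≠ 0) : vanishingIdeal ℂ (chiralSet N d r) ≤ D.ideal d := by
  have hpair := (D.map (MvPolynomial.C (σ := Fin (d + 1)))).pair
  have hsqrt := (D.map (MvPolynomial.C (σ := Fin (d + 1)))).sqrt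
  obtain ⟨P, E, hPE⟩ := isSuperpotentialPair_couplings hrd hpair.natDegree_right hsqrt
    (MvPolynomial.X : Fin (d + 1) → _)
  refine vanishingIdeal_chiralSet_le_ker hrN hr hrd (x := D.genericPoint d) ?_ ?_ hpair hPE
  · exact fun h ↦ hq (MvPolynomial.C_injective _ _ (h.trans (map_zero _).symm))
  -- As `r ≤ d`, the top coupling is one of the free ones.
  · have : D.genericPoint d (Sum.inr (Fin.last d)) = MvPolynomial.X (Fin.last d) :=
      couplings_of_le hsqrt.mul_eq _ (by simpa using hrd)
    rw [this]
    exact MvPolynomial.X_ne_zero _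

end Ideal

end SWData

/-! ### Deformations of a factorization over formal power series -/

section Linear

variable {F : Type} [Field F] {N r : ℕ} {q : F} {A M Y G M₁ Y₁ : F[X]}

theorem exists_gcd_decomposition (hM : M ≠ 0) (Y : F[X]) :
    ∃ G M₁ Y₁ : F[X], M = G * M₁ ∧ Y = G * Y₁ ∧ IsCoprime M₁ Y₁ := by
  classical
  obtain ⟨M₁, hM₁⟩ := EuclideanDomain.gcd_dvd_left M Y
  obtain ⟨Y₁, hY₁⟩ := EuclideanDomain.gcd_dvd_right M Y
  set G := EuclideanDomain.gcd M Y with hG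
  have hG0 : G ≠ 0 := by rintro h; rw [h, zero_mul] at hM₁; exact hM hM₁
  refine ⟨G, M₁, Y₁, hM₁, hY₁, EuclideanDomain.gcdA M Y, EuclideanDomain.gcdB M Y, ?_⟩
  have h := EuclideanDomain.gcd_eq_gcd_ab M Y
  rw [← hG] at h
  apply mul_left_cancel₀ hG0
  linear_combination (-EuclideanDomain.gcdA M Y) * hM₁ - EuclideanDomain.gcdB M Y * hY₁ - h

theorem degree_lt_of_mul {p v : F[X]} {a b : ℕ} (hp : p.natDegree = a) (hp0 : p ≠ 0)
    (h : (p * v).degree < (b : WithBot ℕ)) {c : ℕ} (hc : b ≤ a + c) :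
    v.degree < (c : WithBot ℕ) := by
  by_cases hv : v = 0
  · rw [hv, degree_zero]; exact WithBot.bot_lt_coe c
  · rw [← natDegree_lt_iff_degree_lt (mul_ne_zero hp0 hv), natDegree_mul hp0 hv] at h
    rw [← natDegree_lt_iff_degree_lt hv]
    omega

variable [CharZero F]

/-- A common root of `A` and `M` would force `4q = 0`. -/
theorem isCoprime_of_factorization (hq : q ≠ 0) (h : A ^ 2 - C (4 * q) = M ^ 2 * Y) :
    IsCoprime A M := by
  have hc : C (4 * q)⁻¹ * C (4 * q) = 1 := by
    rw [← C_mul, inv_mul_cancel₀ (mul_ne_zero (by norm_num) hq), C_1]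
  exact ⟨C (4 * q)⁻¹ * A, -(C (4 * q)⁻¹ * (M * Y)), by
    linear_combination C (4 * q)⁻¹ * h + hc⟩

/-- Differentiation gives `2AA' = M(2M'Y + MY')`, where `G` divides the bracket and `A` is coprime
to `M G`. The resulting bound `deg(M G) < N` lets residues modulo `M G` serve as variations of the
monic `A`. -/
theorem mul_gcd_dvd_derivative (hq : q ≠ 0) (h : A ^ 2 - C (4 * q) = M ^ 2 * Y)
    (hM : G ∣ M) (hY : G ∣ Y) : M * G ∣ derivative A := by
  have hco := isCoprime_of_factorization hq h
  have hco' : IsCoprime (M * G) (2 * A) := by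
    have h2 : IsUnit (2 : F[X]) := by
      rw [← C_ofNat]; exact isUnit_C.2 (IsUnit.mk0 _ two_ne_zero)
    rw [isCoprime_mul_unit_left_right h2]
    exact (hco.mul_right (hco.of_isCoprime_of_dvd_right hM)).symm
  apply hco'.dvd_of_dvd_mul_left
  have hd := congrArg derivative h
  simp only [sq, derivative_sub, derivative_mul, derivative_C] at hd
  obtain ⟨a, rfl⟩ := hM
  obtain ⟨b, rfl⟩ := hY
  refine ⟨2 * derivative (G * a) * b + a * (derivative (G * b)), ?_⟩
  simp only [derivative_mul] at hd ⊢
  linear_combination hd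

theorem natDegree_mul_gcd_lt (hA : A.natDegree = N) (hN : 1 ≤ N) (hq : q ≠ 0)
    (h : A ^ 2 - C (4 * q) = M ^ 2 * Y) (hM : G ∣ M) (hY : G ∣ Y) : (M * G).natDegree < N := by
  have hd : (derivative A).natDegree = N - 1 := by rw [natDegree_derivative, hA]
  have h0 : derivative A ≠ 0 := fun h0 ↦ by
    have := derivative_eq_zero.1 h0
    omega
  have := natDegree_le_of_dvd (mul_gcd_dvd_derivative hq h hM hY) h0
  omega

/-- A Bézout relation gives a solution; reducing `m` modulo `M₁` bounds its degree, and the equation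
then bounds that of `y`. -/
theorem exists_solution_of_coprime (hM₁ : M₁ ≠ 0) (hY₁ : Y₁ ≠ 0) (hco : IsCoprime M₁ Y₁)
    {a b n : ℕ} (ha : M₁.natDegree = a) (hb : Y₁.natDegree + a ≤ n) (v : F[X])
    (hv : v.degree < (n : WithBot ℕ)) (hbn : n ≤ a + b) :
    ∃ m y : F[X], m.degree < (a : WithBot ℕ) ∧ y.degree < (b : WithBot ℕ) ∧
      2 * Y₁ * m + M₁ * y = v := by
  obtain ⟨α, β, hαβ⟩ := hco
  set m' := (v * β) % M₁
  have hm' : m'.degree < M₁.degree := EuclideanDomain.mod_lt _ hM₁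
  have hdiv : M₁ * ((v * β) / M₁) + m' = v * β := EuclideanDomain.div_add_mod _ _
  have h2 : (2 : F[X]) * C 2⁻¹ = 1 := by
    rw [← C_ofNat, ← C_mul, mul_inv_cancel₀ two_ne_zero, C_1]
  have e : Y₁ * m' + M₁ * (v * α + Y₁ * ((v * β) / M₁)) = v := by
    linear_combination Y₁ * hdiv + v * hαβ
  refine ⟨C 2⁻¹ * m', v * α + Y₁ * ((v * β) / M₁), ?_, ?_, ?_⟩
  · rw [degree_C_mul (inv_ne_zero two_ne_zero)]
    rwa [degree_eq_natDegree hM₁, ha] at hm'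
  · refine degree_lt_of_mul ha hM₁ (b := n) ?_ hbn
    have e' : M₁ * (v * α + Y₁ * ((v * β) / M₁)) = v - Y₁ * m' := by linear_combination e
    rw [e']
    refine (degree_sub_le _ _).trans_lt (max_lt hv ?_)
    by_cases h0 : m' = 0
    · rw [h0, mul_zero, degree_zero]; exact WithBot.bot_lt_coe n
    · rw [← natDegree_lt_iff_degree_lt (mul_ne_zero hY₁ h0), natDegree_mul hY₁ h0]
      have := natDegree_lt_natDegree h0 hm'
      omega
  · linear_combination (Y₁ * m') * h2 + e

/-- The factor `M`, `Y` can be deformed so as to realize any multiple of `M gcd(M, Y)`. -/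
theorem exists_solution_of_mul_gcd (hM : M = G * M₁) (hY : Y = G * Y₁) (hco : IsCoprime M₁ Y₁)
    (hM0 : M ≠ 0) (hY0 : Y ≠ 0) (hMr : M.natDegree = N - r) (hYr : Y.natDegree = 2 * r)
    (hrN : r ≤ N) (v : F[X]) (hv : (M * G * v).degree < ((2 * N : ℕ) : WithBot ℕ)) :
    ∃ m y : F[X], m.degree < ((N - r : ℕ) : WithBot ℕ) ∧ y.degree < ((2 * r : ℕ) : WithBot ℕ) ∧
      2 * M * Y * m + M ^ 2 * y = M * G * v := by
  have hG0 : G ≠ 0 := by rintro rfl; simp at hM; exact hM0 hM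
  have hM₁ : M₁ ≠ 0 := by rintro rfl; simp at hM; exact hM0 hM
  have hY₁ : Y₁ ≠ 0 := by rintro rfl; simp at hY; exact hY0 hY
  have d₁ : G.natDegree + M₁.natDegree = N - r := by rw [← hMr, hM, natDegree_mul hG0 hM₁]
  have d₂ : G.natDegree + Y₁.natDegree = 2 * r := by rw [← hYr, hY, natDegree_mul hG0 hY₁]
  have hv' : v.degree < ((N + r - G.natDegree : ℕ) : WithBot ℕ) :=
    degree_lt_of_mul (natDegree_mul hM0 hG0) (mul_ne_zero hM0 hG0) hv (by omega)
  obtain ⟨m, y, hm, hy, e⟩ := exists_solution_of_coprime hM₁ hY₁ hco (b := 2 * r) rfl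
    (by omega) v hv' (by omega)
  refine ⟨m, y, hm.trans_le ?_, hy, ?_⟩
  · exact Nat.cast_le.2 (by omega)
  · rw [hY]
    linear_combination (M * G) * e + M * y * hM

/-- The linearization of the factorization condition is surjective. -/
theorem exists_solution (hA : A.natDegree = N) (hN : 1 ≤ N) (hq : q ≠ 0)
    (h : A ^ 2 - C (4 * q) = M ^ 2 * Y) (hM0 : M ≠ 0) (hY0 : Y ≠ 0) (hMr : M.natDegree = N - r)
    (hYr : Y.natDegree = 2 * r) (hrN : r ≤ N) (w : F[X])
    (hw : w.degree < ((2 * N : ℕ) : WithBot ℕ)) :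
    ∃ a m y : F[X], a.degree < (N : WithBot ℕ) ∧ m.degree < ((N - r : ℕ) : WithBot ℕ) ∧
      y.degree < ((2 * r : ℕ) : WithBot ℕ) ∧ 2 * M * Y * m + M ^ 2 * y - 2 * A * a = w := by
  obtain ⟨G, M₁, Y₁, hM, hY, hco⟩ := exists_gcd_decomposition hM0 Y
  have hG0 : G ≠ 0 := by rintro rfl; simp at hM; exact hM0 hM
  have hMG : M * G ≠ 0 := mul_ne_zero hM0 hG0
  have hlt := natDegree_mul_gcd_lt hA hN hq h ⟨_, hM⟩ ⟨_, hY⟩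
  have hcoA := isCoprime_of_factorization hq h
  have h2 : IsUnit (2 : F[X]) := by
    rw [← C_ofNat]; exact isUnit_C.2 (IsUnit.mk0 _ two_ne_zero)
  have hcop : IsCoprime (2 * A) (M * G) := by
    rw [isCoprime_mul_unit_left_left h2]
    exact hcoA.mul_right (hcoA.of_isCoprime_of_dvd_right ⟨_, hM⟩)
  obtain ⟨α, β, hαβ⟩ := hcop
  -- Since `2A` is invertible modulo `M G` with inverse `α`, this residue solves `w + 2Aa ≡ 0`; what
  -- is left is a multiple of `M G`, which variations of `M` and `Y` can realize.
  set a := (-w * α) % (M * G)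
  have ha : a.degree < (N : WithBot ℕ) := by
    refine (EuclideanDomain.mod_lt (-w * α) hMG).trans ?_
    rw [degree_eq_natDegree hMG]
    exact Nat.cast_lt.2 hlt
  have hdiv : M * G * ((-w * α) / (M * G)) + a = -w * α := EuclideanDomain.div_add_mod _ _
  have e : w + 2 * A * a = M * G * (w * β - 2 * A * ((-w * α) / (M * G))) := by
    linear_combination (-w) * hαβ + 2 * A * hdiv
  obtain ⟨m, y, hm, hy, e'⟩ := exists_solution_of_mul_gcd hM hY hco hM0 hY0 hMr hYr hrN
    (w * β - 2 * A * ((-w * α) / (M * G))) (by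
      rw [← e]
      refine (degree_add_le _ _).trans_lt (max_lt hw ?_)
      by_cases h0 : a = 0
      · rw [h0, mul_zero, degree_zero]; exact WithBot.bot_lt_coe _
      · have hA0 : A ≠ 0 := by rintro rfl; simp at hA; omega
        have : (2 * A * a).natDegree = N + a.natDegree := by
          rw [mul_assoc, ← C_ofNat, natDegree_C_mul two_ne_zero, natDegree_mul hA0 h0, hA]
        rw [← natDegree_lt_iff_degree_lt (mul_ne_zero (mul_ne_zero h2.ne_zero hA0) h0), this]
        have := (natDegree_lt_iff_degree_lt h0).2 ha
        omega)
  exact ⟨a, m, y, ha, hm, hy, by linear_combination e' - e⟩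

end Linear

/-! ### `ε`-adic limits of polynomials over power series -/

section Limits

variable {F : Type} [Field F]

theorem C_X_dvd_iff {p : F⟦X⟧[X]} :
    C PowerSeries.X ∣ p ↔ p.map PowerSeries.constantCoeff = 0 := by
  simp [C_dvd_iff_dvd_coeff, PowerSeries.X_dvd_iff, Polynomial.ext_iff]

theorem C_X_pow_dvd_iff {n : ℕ} {p : F⟦X⟧[X]} :
    C PowerSeries.X ^ n ∣ p ↔ ∀ i, ∀ j < n, PowerSeries.coeff j (p.coeff i) = 0 := by
  rw [← C_pow, C_dvd_iff_dvd_coeff]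
  exact forall_congr' fun i ↦ PowerSeries.X_pow_dvd_iff

theorem eq_zero_of_C_X_pow_dvd {p : F⟦X⟧[X]} (h : ∀ n, C PowerSeries.X ^ n ∣ p) : p = 0 := by
  ext i j
  simpa using C_X_pow_dvd_iff.1 (h (j + 1)) i j (Nat.lt_succ_self j)

theorem C_X_pow_dvd_sub_of_le {p : ℕ → F⟦X⟧[X]}
    (h : ∀ n, C PowerSeries.X ^ n ∣ p (n + 1) - p n) {n m : ℕ} (hnm : n ≤ m) :
    C PowerSeries.X ^ n ∣ p m - p n := by
  induction m, hnm using Nat.le_induction with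
  | base => simp
  | succ m hm ih =>
    have := ((pow_dvd_pow (C PowerSeries.X) hm).trans (h m)).add ih
    rwa [sub_add_sub_cancel] at this

/-- A Cauchy sequence of monic polynomials over a power series ring converges. -/
theorem exists_limit {p : ℕ → F⟦X⟧[X]} {k : ℕ} (hm : ∀ n, (p n).Monic)
    (hk : ∀ n, (p n).natDegree = k) (h : ∀ n, C PowerSeries.X ^ n ∣ p (n + 1) - p n) :
    ∃ l : F⟦X⟧[X], l.Monic ∧ l.natDegree = k ∧ ∀ n, C PowerSeries.X ^ n ∣ l - p n := by
  let l : F⟦X⟧[X] := ∑ i ∈ Finset.range (k + 1),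
    C (PowerSeries.mk fun j ↦ PowerSeries.coeff j ((p (j + 1)).coeff i)) * X ^ i
  have hl (i j : ℕ) : PowerSeries.coeff j (l.coeff i) =
      PowerSeries.coeff j ((p (j + 1)).coeff i) := by
    simp only [l, finsetSum_coeff, coeff_C_mul, coeff_X_pow, mul_ite, mul_one, mul_zero,
      Finset.sum_ite_eq, Finset.mem_range]
    split_ifs with hi
    · simp
    · rw [coeff_eq_zero_of_natDegree_lt (by rw [hk]; omega)]
  have hone : l.coeff k = 1 := by
    ext j
    rw [hl, ← hk (j + 1), (hm (j + 1)).coeff_natDegree]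
  have hle : l.natDegree ≤ k := natDegree_le_iff_coeff_eq_zero.2 fun i hi ↦ by
    ext j
    rw [hl, coeff_eq_zero_of_natDegree_lt (by rw [hk]; omega)]
  refine ⟨l, monic_of_natDegree_le_of_coeff_eq_one k hle hone,
    natDegree_eq_of_le_of_coeff_ne_zero hle (by rw [hone]; exact one_ne_zero), fun n ↦ ?_⟩
  refine C_X_pow_dvd_iff.2 fun i j hj ↦ ?_
  have := C_X_pow_dvd_iff.1 (C_X_pow_dvd_sub_of_le h (Nat.succ_le_of_lt hj)) i j
    (Nat.lt_succ_self j)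
  rw [coeff_sub, map_sub, sub_eq_zero] at this
  rw [coeff_sub, map_sub, hl, this, sub_self]

theorem exists_seq_of_step {α : Type} {P : ℕ → α → Prop} {rel : ℕ → α → α → Prop} {x₀ : α}
    (h₀ : P 0 x₀) (h : ∀ n x, P n x → ∃ y, P (n + 1) y ∧ rel n x y) :
    ∃ f : ℕ → α, f 0 = x₀ ∧ ∀ n, P n (f n) ∧ rel n (f n) (f (n + 1)) := by
  choose! g hg using h
  let f : ℕ → α := fun n ↦ Nat.rec x₀ (fun n x ↦ g n x) n
  have hf (n : ℕ) : P n (f n) := by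
    induction n with
    | zero => exact h₀
    | succ n ih => exact (hg n _ ih).1
  exact ⟨f, rfl, fun n ↦ ⟨hf n, (hg n _ (hf n)).2⟩⟩

end Limits

/-! ### Formal arcs of factorizations -/

section Arc

variable {F : Type} [Field F] {N r : ℕ}

/-- Monic polynomials over `F⟦ε⟧` of the given degrees that satisfy the factorization condition
modulo `ε^n` and reduce to `A`, `M`, `Y`. -/
structure IsApproximation (N r : ℕ) (q : F) (A M Y : F[X]) (n : ℕ)
    (x : F⟦X⟧[X] × F⟦X⟧[X] × F⟦X⟧[X]) : Prop where
  monic₁ : x.1.Monic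
  natDegree₁ : x.1.natDegree = N
  monic₂ : x.2.1.Monic
  natDegree₂ : x.2.1.natDegree = N - r
  monic₃ : x.2.2.Monic
  natDegree₃ : x.2.2.natDegree = 2 * r
  map₁ : x.1.map PowerSeries.constantCoeff = A
  map₂ : x.2.1.map PowerSeries.constantCoeff = M
  map₃ : x.2.2.map PowerSeries.constantCoeff = Y
  dvd : C PowerSeries.X ^ n ∣ x.1 ^ 2 - C (PowerSeries.C (4 * q)) - x.2.1 ^ 2 * x.2.2

theorem degree_C_X_pow_mul_map_lt {n k : ℕ} {p : F[X]} (h : p.degree < (k : WithBot ℕ)) :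
    (C PowerSeries.X ^ n * p.map PowerSeries.C : F⟦X⟧[X]).degree < (k : WithBot ℕ) := by
  rw [← C_pow, degree_C_mul (pow_ne_zero n PowerSeries.X_ne_zero)]
  exact degree_map_le.trans_lt h

theorem monic_add_C_X_pow_mul {n k : ℕ} {p : F⟦X⟧[X]} (hp : p.Monic) (hk : p.natDegree = k)
    {a : F[X]} (h : a.degree < (k : WithBot ℕ)) :
    (p + C PowerSeries.X ^ n * a.map PowerSeries.C).Monic ∧
      (p + C PowerSeries.X ^ n * a.map PowerSeries.C).natDegree = k := by
  have hlt : (C PowerSeries.X ^ n * a.map PowerSeries.C : F⟦X⟧[X]).degree < p.degree := by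
    rw [degree_eq_natDegree hp.ne_zero, hk]
    exact degree_C_X_pow_mul_map_lt h
  exact ⟨hp.add_of_left hlt, by rw [natDegree_add_eq_left_of_degree_lt hlt, hk]⟩

theorem map_add_C_X_pow_mul {n : ℕ} (hn : n ≠ 0) (p : F⟦X⟧[X]) (a : F[X]) :
    (p + C PowerSeries.X ^ n * a.map PowerSeries.C).map PowerSeries.constantCoeff =
      p.map PowerSeries.constantCoeff := by
  simp [hn]

theorem map_map_constantCoeff (a : F[X]) :
    (a.map PowerSeries.C).map (PowerSeries.constantCoeff (R := F)) = a := by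
  ext; simp

/-- This is a Newton step: the coefficient of `ε^n` in the error is cancelled by solving the
linearized equation at `(A, M, Y)`. -/
theorem IsApproximation.exists_next [CharZero F] {q : F} {A M Y : F[X]} {n : ℕ} (hn : n ≠ 0)
    {x : F⟦X⟧[X] × F⟦X⟧[X] × F⟦X⟧[X]} (hx : IsApproximation N r q A M Y n x) (hr : 1 ≤ r)
    (hrN : r ≤ N) (hq : q ≠ 0) (h : A ^ 2 - C (4 * q) = M ^ 2 * Y) :
    ∃ y, IsApproximation N r q A M Y (n + 1) y ∧ C PowerSeries.X ^ n ∣ y.1 - x.1 ∧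
      C PowerSeries.X ^ n ∣ y.2.1 - x.2.1 ∧ C PowerSeries.X ^ n ∣ y.2.2 - x.2.2 := by
  obtain ⟨A', M', Y'⟩ := x
  obtain ⟨hA, hAd, hM, hMd, hY, hYd, hA0, hM0, hY0, W, hW⟩ := hx
  dsimp only at *
  -- Both sides of the factorization are monic of degree `2N`, so the leading terms cancel in the
  -- error.
  have hWdeg : W.degree < ((2 * N : ℕ) : WithBot ℕ) := by
    have hA2 : (A' ^ 2).degree = ((2 * N : ℕ) : WithBot ℕ) := by
      rw [degree_eq_natDegree (hA.pow 2).ne_zero, hA.natDegree_pow, hAd]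
    have hM2 : (M' ^ 2 * Y').degree = ((2 * N : ℕ) : WithBot ℕ) := by
      rw [degree_eq_natDegree ((hM.pow 2).mul hY).ne_zero, (hM.pow 2).natDegree_mul hY,
        hM.natDegree_pow, hMd, hYd]
      congr 1
      omega
    have hC : (C (PowerSeries.C (4 * q)) : F⟦X⟧[X]).degree < (A' ^ 2).degree := by
      rw [hA2]
      refine degree_C_le.trans_lt ?_
      exact Nat.cast_lt.2 (by omega : 0 < 2 * N)
    have e : W.degree = (C PowerSeries.X ^ n * W).degree := by
      rw [← C_pow, degree_C_mul (pow_ne_zero n PowerSeries.X_ne_zero)]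
    have hd : (A' ^ 2 - C (PowerSeries.C (4 * q))).degree = (M' ^ 2 * Y').degree := by
      rw [degree_sub_eq_left_of_degree_lt hC, hA2, hM2]
    rw [e, ← hW, ← hM2, ← hd]
    refine degree_sub_lt_left hd ?_ ?_
    · intro h0; rw [h0, degree_zero, hM2] at hd; exact absurd hd WithBot.bot_ne_coe
    · rw [((hA.pow 2).sub_of_left hC).leadingCoeff, ((hM.pow 2).mul hY).leadingCoeff]
  have hMm : M.Monic := hM0 ▸ hM.map _
  have hYm : Y.Monic := hY0 ▸ hY.map _
  obtain ⟨a, m, y, ha, hm, hy, e⟩ := exists_solution (r := r) (N := N)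
    (by rw [← hA0, hA.natDegree_map, hAd]) (by omega) hq h hMm.ne_zero hYm.ne_zero
    (by rw [← hM0, hM.natDegree_map, hMd]) (by rw [← hY0, hY.natDegree_map, hYd]) hrN
    (W.map PowerSeries.constantCoeff) (degree_map_le.trans_lt hWdeg)
  refine ⟨(A' + C PowerSeries.X ^ n * a.map PowerSeries.C,
    M' + C PowerSeries.X ^ n * m.map PowerSeries.C,
    Y' + C PowerSeries.X ^ n * y.map PowerSeries.C), ⟨?_, ?_, ?_, ?_, ?_, ?_, ?_, ?_, ?_, ?_⟩,
    ⟨a.map PowerSeries.C, add_sub_cancel_left _ _⟩, ⟨m.map PowerSeries.C, add_sub_cancel_left _ _⟩,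
    ⟨y.map PowerSeries.C, add_sub_cancel_left _ _⟩⟩
  · exact (monic_add_C_X_pow_mul hA hAd ha).1
  · exact (monic_add_C_X_pow_mul hA hAd ha).2
  · exact (monic_add_C_X_pow_mul hM hMd hm).1
  · exact (monic_add_C_X_pow_mul hM hMd hm).2
  · exact (monic_add_C_X_pow_mul hY hYd hy).1
  · exact (monic_add_C_X_pow_mul hY hYd hy).2
  · exact (map_add_C_X_pow_mul hn _ _).trans hA0
  · exact (map_add_C_X_pow_mul hn _ _).trans hM0
  · exact (map_add_C_X_pow_mul hn _ _).trans hY0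
  · dsimp only
    set a' := a.map (PowerSeries.C (R := F)) with ha'
    set m' := m.map (PowerSeries.C (R := F)) with hm'
    set y' := y.map (PowerSeries.C (R := F)) with hy'
    set ε : F⟦X⟧[X] := C PowerSeries.X with hε
    obtain ⟨Z, hZ⟩ : ε ∣ W + 2 * A' * a' - 2 * M' * Y' * m' - M' ^ 2 * y' := by
      rw [hε, C_X_dvd_iff]
      simp only [Polynomial.map_sub, Polynomial.map_add, Polynomial.map_mul, Polynomial.map_pow,
        Polynomial.map_ofNat, hA0, hM0, hY0, ha', hm', hy', map_map_constantCoeff]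
      linear_combination -e
    -- With `n = k + 1`, the quadratic corrections carry `ε^(2n) = ε^(n+1) ε^k`, so they are
    -- absorbed in the next order.
    obtain ⟨k, rfl⟩ := Nat.exists_eq_succ_of_ne_zero hn
    refine ⟨Z + ε ^ k * (a' ^ 2 - m' ^ 2 * Y' - 2 * M' * m' * y' - ε ^ (k + 1) * m' ^ 2 * y'), ?_⟩
    simp only [Nat.succ_eq_add_one] at hW ⊢
    linear_combination hW + ε ^ (k + 1) * hZ

/-- Moving `A` by `ε M G` changes `A²` by `2A·M G` to first order, a multiple of `M G` that
variations of `M` and `Y` can match; Newton steps extend this to all orders. `IsApproximation` at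
order `0` records only the degrees, monicity and reductions. -/
theorem exists_arc [CharZero F] {q : F} {A M Y : F[X]} (hr : 1 ≤ r) (hrN : r ≤ N) (hq : q ≠ 0)
    (h : A ^ 2 - C (4 * q) = M ^ 2 * Y) (hA : A.Monic) (hAN : A.natDegree = N) (hM : M.Monic)
    (hMr : M.natDegree = N - r) (hY : Y.Monic) (hYr : Y.natDegree = 2 * r) :
    ∃ G, G ∣ M ∧ ∃ A' M' Y' : F⟦X⟧[X], IsApproximation N r q A M Y 0 (A', M', Y') ∧
      A' ^ 2 - C (PowerSeries.C (4 * q)) = M' ^ 2 * Y' ∧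
      C PowerSeries.X ^ 2 ∣
        A' - (A.map PowerSeries.C + C PowerSeries.X * (M * G).map PowerSeries.C) := by
  obtain ⟨G, M₁, Y₁, hMG, hYG, hco⟩ := exists_gcd_decomposition hM.ne_zero Y
  have hlt := natDegree_mul_gcd_lt hAN (by omega) hq h ⟨_, hMG⟩ ⟨_, hYG⟩
  have hG0 : G ≠ 0 := by rintro rfl; simp at hMG; exact hM.ne_zero hMG
  have hMG0 : M * G ≠ 0 := mul_ne_zero hM.ne_zero hG0
  have hMGdeg : (M * G).degree < (N : WithBot ℕ) := (natDegree_lt_iff_degree_lt hMG0).1 hlt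
  obtain ⟨m, y, hm, hy, e⟩ := exists_solution_of_mul_gcd hMG hYG hco hM.ne_zero hY.ne_zero hMr hYr
    hrN (2 * A) (by
      have h2A : (2 * A) ≠ 0 := mul_ne_zero two_ne_zero hA.ne_zero
      rw [← natDegree_lt_iff_degree_lt (mul_ne_zero hMG0 h2A), natDegree_mul hMG0 h2A,
        ← C_ofNat, natDegree_C_mul two_ne_zero, hAN]
      omega)
  refine ⟨G, ⟨_, hMG⟩, ?_⟩
  set ε : F⟦X⟧[X] := C PowerSeries.X with hε
  have hstart : IsApproximation N r q A M Y 2 (A.map PowerSeries.C + ε ^ 1 * (M * G).map PowerSeries.C,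
      M.map PowerSeries.C + ε ^ 1 * m.map PowerSeries.C,
      Y.map PowerSeries.C + ε ^ 1 * y.map PowerSeries.C) := by
    have hAd : (A.map (PowerSeries.C (R := F))).natDegree = N := by rw [hA.natDegree_map, hAN]
    have hMd : (M.map (PowerSeries.C (R := F))).natDegree = N - r := by rw [hM.natDegree_map, hMr]
    have hYd : (Y.map (PowerSeries.C (R := F))).natDegree = 2 * r := by rw [hY.natDegree_map, hYr]
    have hA' := hA.map (PowerSeries.C (R := F))
    have hM' := hM.map (PowerSeries.C (R := F))
    have hY' := hY.map (PowerSeries.C (R := F))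
    refine ⟨(monic_add_C_X_pow_mul hA' hAd hMGdeg).1, (monic_add_C_X_pow_mul hA' hAd hMGdeg).2,
      (monic_add_C_X_pow_mul hM' hMd hm).1, (monic_add_C_X_pow_mul hM' hMd hm).2,
      (monic_add_C_X_pow_mul hY' hYd hy).1, (monic_add_C_X_pow_mul hY' hYd hy).2,
      (map_add_C_X_pow_mul one_ne_zero _ _).trans (map_map_constantCoeff _),
      (map_add_C_X_pow_mul one_ne_zero _ _).trans (map_map_constantCoeff _),
      (map_add_C_X_pow_mul one_ne_zero _ _).trans (map_map_constantCoeff _), ?_⟩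
    have h' := congrArg (Polynomial.map (PowerSeries.C (R := F))) h
    have e' := congrArg (Polynomial.map (PowerSeries.C (R := F))) e
    simp only [Polynomial.map_sub, Polynomial.map_add, Polynomial.map_mul, Polynomial.map_pow,
      Polynomial.map_ofNat, Polynomial.map_C] at h' e' ⊢
    refine ⟨(M.map PowerSeries.C * G.map PowerSeries.C) ^ 2 -
      (m.map PowerSeries.C ^ 2 * Y.map PowerSeries.C +
        2 * M.map PowerSeries.C * m.map PowerSeries.C * y.map PowerSeries.C +
        ε * m.map PowerSeries.C ^ 2 * y.map PowerSeries.C), ?_⟩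
    linear_combination h' - ε * e'
  -- Starting at order `2` leaves the chosen first-order term of `A'` untouched by all later
  -- corrections.
  obtain ⟨f, hf0, hf⟩ := exists_seq_of_step (P := fun n ↦ IsApproximation N r q A M Y (n + 2))
    (rel := fun n x y ↦ ε ^ (n + 2) ∣ y.1 - x.1 ∧ ε ^ (n + 2) ∣ y.2.1 - x.2.1 ∧
      ε ^ (n + 2) ∣ y.2.2 - x.2.2) hstart
    (fun n x hx ↦ hx.exists_next (by omega) hr hrN hq h)
  have hpow (n : ℕ) : ε ^ n ∣ ε ^ (n + 2) := pow_dvd_pow _ (by omega)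
  obtain ⟨A', hA'm, hA'd, hA'⟩ := exists_limit (fun n ↦ (hf n).1.monic₁)
    (fun n ↦ (hf n).1.natDegree₁) fun n ↦ (hpow n).trans (hf n).2.1
  obtain ⟨M', hM'm, hM'd, hM'⟩ := exists_limit (fun n ↦ (hf n).1.monic₂)
    (fun n ↦ (hf n).1.natDegree₂) fun n ↦ (hpow n).trans (hf n).2.2.1
  obtain ⟨Y', hY'm, hY'd, hY'⟩ := exists_limit (fun n ↦ (hf n).1.monic₃)
    (fun n ↦ (hf n).1.natDegree₃) fun n ↦ (hpow n).trans (hf n).2.2.2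
  have hred {p p' : F⟦X⟧[X]} (hp : ε ^ 1 ∣ p - p') :
      p.map PowerSeries.constantCoeff = p'.map PowerSeries.constantCoeff := by
    rw [pow_one, hε, C_X_dvd_iff, Polynomial.map_sub, sub_eq_zero] at hp
    exact hp
  refine ⟨A', M', Y', ⟨hA'm, hA'd, hM'm, hM'd, hY'm, hY'd,
    (hred (hA' 1)).trans (hf 1).1.map₁, (hred (hM' 1)).trans (hf 1).1.map₂,
    (hred (hY' 1)).trans (hf 1).1.map₃, by simp⟩, ?_, ?_⟩
  · refine sub_eq_zero.1 (eq_zero_of_C_X_pow_dvd fun n ↦ ?_)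
    obtain ⟨a, ha⟩ := hA' n
    obtain ⟨b, hb⟩ := hM' n
    obtain ⟨c, hc⟩ := hY' n
    obtain ⟨z, hz⟩ := (hpow n).trans (hf n).1.dvd
    refine ⟨z + a * (A' + (f n).1) - b * (M' + (f n).2.1) * Y' - (f n).2.1 ^ 2 * c, ?_⟩
    linear_combination hz + (A' + (f n).1) * ha - (M' + (f n).2.1) * Y' * hb - (f n).2.1 ^ 2 * hc
  · have h1 := (hf 0).2.1
    have h2 := (pow_dvd_pow ε (by omega : 2 ≤ 1 + 2)).trans (hf 1).2.1
    have := (hA' 2).add (h2.add h1)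
    rw [hf0] at this
    rw [pow_one] at this
    convert! this using 1
    simp only [zero_add, Nat.reduceAdd]
    ring

end Arc

/-! ### Square-freeness at the generic point -/

section Squarefree

variable {K F : Type} [Field K] [Field F]

theorem exists_irreducible_dvd_map (φ : K →+* F) {π : F[X]} (hπ : Irreducible π) {f : K[X]}
    (hf : f ≠ 0) (h : π ∣ f.map φ) : ∃ p : K[X], Irreducible p ∧ p ∣ f ∧ π ∣ p.map φ := by
  induction f using WfDvdMonoid.induction_on_irreducible with
  | zero => exact absurd rfl hf
  | unit u hu => exact absurd (isUnit_of_dvd_unit h (hu.map (mapRingHom φ))) hπ.not_isUnit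
  | mul a i ha hi ih =>
    rw [Polynomial.map_mul] at h
    rcases hπ.prime.dvd_or_dvd h with h | h
    · exact ⟨i, hi, dvd_mul_right _ _, h⟩
    · obtain ⟨p, hp, hpa, hpi⟩ := ih ha h
      exact ⟨p, hp, hpa.mul_left _, hpi⟩

/-- Interchange of polynomials and formal power series. -/
def polynomialPowerSeriesSwap (F : Type) [Field F] : F⟦X⟧[X] →+* F[X]⟦X⟧ :=
  eval₂RingHom (PowerSeries.map C) (PowerSeries.C X)

theorem polynomialPowerSeriesSwap_C_X :
    polynomialPowerSeriesSwap F (C PowerSeries.X) = PowerSeries.X := by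
  simp [polynomialPowerSeriesSwap]

theorem polynomialPowerSeriesSwap_map_C (p : F[X]) :
    polynomialPowerSeriesSwap F (p.map PowerSeries.C) = PowerSeries.C p := by
  have : ((polynomialPowerSeriesSwap F).comp (mapRingHom PowerSeries.C)) = PowerSeries.C := by
    ext <;> simp [polynomialPowerSeriesSwap]
  exact congrArg (fun θ : F[X] →+* F[X]⟦X⟧ ↦ θ p) this

theorem constantCoeff_polynomialPowerSeriesSwap (p : F⟦X⟧[X]) :
    PowerSeries.constantCoeff (polynomialPowerSeriesSwap F p) =
      p.map PowerSeries.constantCoeff := by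
  have : (PowerSeries.constantCoeff.comp (polynomialPowerSeriesSwap F)) =
      mapRingHom PowerSeries.constantCoeff := by
    refine Polynomial.ringHom_ext (fun a ↦ ?_) (by simp [polynomialPowerSeriesSwap])
    rw [RingHom.comp_apply, polynomialPowerSeriesSwap, coe_eval₂RingHom, eval₂_C, coe_mapRingHom,
      Polynomial.map_C, ← PowerSeries.coeff_zero_eq_constantCoeff_apply, PowerSeries.coeff_map,
      PowerSeries.coeff_zero_eq_constantCoeff_apply]
  exact congrArg (fun θ : F⟦X⟧[X] →+* F[X] ↦ θ p) this

/-- By the product rule, the derivative of `p^e u` at `0` still contains `p(0)^(e-1)`. -/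
theorem pow_dvd_coeff_one {S : Type} [CommRing S] (p u : S⟦X⟧) (e : ℕ) :
    PowerSeries.constantCoeff p ^ (e - 1) ∣ PowerSeries.coeff 1 (p ^ e * u) := by
  rw [PowerSeries.coeff_one_mul, PowerSeries.coeff_one_pow, map_pow]
  refine dvd_add ?_ ?_
  · exact ((dvd_refl _).mul_left _).mul_right _
  · exact (pow_dvd_pow _ (Nat.sub_le _ _)).mul_left _

/-- If the factorization `A² - 4q = M² Y` deforms in the direction `M G` with `G ∣ M`, along an
embedding of a field of definition of `A² - 4q` into the power series field, then `Y` is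
square-free. -/
theorem squarefree_of_arc [CharZero K] [CharZero F] {φ : K →+* F} {ψ : K →+* F⟦X⟧}
    (hψ : PowerSeries.constantCoeff.comp ψ = φ) {f : K[X]} {q : F} (hq : q ≠ 0)
    {A M Y G : F[X]} (hGM : G ∣ M) (hY : Y ≠ 0) (hM : M ≠ 0) (hfφ : f.map φ = A ^ 2 - C (4 * q))
    (h : A ^ 2 - C (4 * q) = M ^ 2 * Y) {A' : F⟦X⟧[X]}
    (hfψ : f.map ψ = A' ^ 2 - C (PowerSeries.C (4 * q)))
    (hA' : C PowerSeries.X ^ 2 ∣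
        A' - (A.map PowerSeries.C + C PowerSeries.X * (M * G).map PowerSeries.C)) :
    Squarefree Y := by
  rw [squarefree_iff_irreducible_sq_not_dvd_of_ne_zero hY]
  intro π hπ hπY
  have hf0 : f ≠ 0 := by
    rintro rfl
    rw [h, Polynomial.map_zero] at hfφ
    exact mul_ne_zero (pow_ne_zero 2 hM) hY hfφ.symm
  have hπf : π ∣ f.map φ := by
    rw [hfφ, h]; exact ((dvd_mul_right π π).trans hπY).mul_left _
  obtain ⟨p, hp, hpf, hπp⟩ := exists_irreducible_dvd_map φ hπ hf0 hπf
  obtain ⟨e, u, hpu, hfe⟩ := WfDvdMonoid.max_power_factor hf0 hp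
  obtain ⟨m, M₂, hπM₂, hMm⟩ := WfDvdMonoid.max_power_factor hM hπ
  have hπu : ¬ π ∣ u.map φ := by
    intro hπu
    have hco : IsCoprime (p.map φ) (u.map φ) :=
      ((hp.coprime_iff_not_dvd).2 hpu).map (mapRingHom φ)
    exact hπ.not_isUnit (hco.isUnit_of_dvd' hπp hπu)
  obtain ⟨t, ht⟩ := hπp
  have hπt : ¬ π ∣ t := by
    rintro ⟨t', rfl⟩
    have hsq : Squarefree (p.map φ) := hp.separable.map.squarefree
    exact hπ.not_isUnit (hsq π ⟨t', by rw [ht, mul_assoc]⟩)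
  -- `π` divides `f` to order at least `2m + 2`, and does so only through `p^e`, with `p` containing
  -- `π` exactly once because `p` is separable.
  have he : 2 * m + 2 ≤ e := by
    have h₁ : π ^ (2 * m + 2) ∣ p.map φ ^ e * u.map φ := by
      rw [← Polynomial.map_pow, ← Polynomial.map_mul, ← hfe, hfφ, h, hMm]
      obtain ⟨y, rfl⟩ := hπY
      exact ⟨M₂ ^ 2 * y, by ring⟩
    have h₂ := hπ.prime.pow_dvd_of_dvd_mul_right _ hπu h₁
    rw [ht, mul_pow] at h₂
    have h₃ := hπ.prime.pow_dvd_of_dvd_mul_right _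
      (fun h ↦ hπt (hπ.prime.dvd_of_dvd_pow h)) h₂
    exact (pow_dvd_pow_iff hπ.ne_zero hπ.not_isUnit).1 h₃
  have hπA : ¬ π ∣ 2 * A := by
    intro hπA
    have h2 : IsUnit (2 : F[X]) := by
      rw [← C_ofNat]; exact isUnit_C.2 (IsUnit.mk0 _ two_ne_zero)
    have hπA := (h2.dvd_mul_left).1 hπA
    have hc : π ∣ C (4 * q) := by
      have := (hπA.mul_right A).sub (hfφ ▸ hπf)
      rwa [← sq, sub_sub_cancel] at this
    exact hπ.not_isUnit (isUnit_of_dvd_unit hc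
      (isUnit_C.2 (IsUnit.mk0 _ (mul_ne_zero (by norm_num) hq))))
  -- The factorization `f = p^e u` over `K` is carried to the arc by `ψ`. The first-order term of
  -- `f` along the arc is `2A·M G`, hence divisible by `π^(e-1)`.
  have hder : π ^ (2 * m + 1) ∣ 2 * A * (M * G) := by
    have h₁ := pow_dvd_coeff_one (polynomialPowerSeriesSwap F (p.map ψ))
      (polynomialPowerSeriesSwap F (u.map ψ)) e
    rw [← map_pow (polynomialPowerSeriesSwap F) _ e, ← map_mul (polynomialPowerSeriesSwap F),
      ← Polynomial.map_pow, ← Polynomial.map_mul, ← hfe, hfψ, constantCoeff_polynomialPowerSeriesSwap, Polynomial.map_map, hψ, ht] at h₁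
    obtain ⟨Z, hZ⟩ := hA'
    have hSA : polynomialPowerSeriesSwap F A' = PowerSeries.C A +
        PowerSeries.X * PowerSeries.C (M * G) +
          PowerSeries.X ^ 2 * polynomialPowerSeriesSwap F Z := by
      rw [sub_eq_iff_eq_add.1 hZ, map_add, map_mul, map_pow, map_add, map_mul,
        polynomialPowerSeriesSwap_C_X, polynomialPowerSeriesSwap_map_C,
        polynomialPowerSeriesSwap_map_C]
      ring
    have h₀ : PowerSeries.constantCoeff (polynomialPowerSeriesSwap F A') = A := by simp [hSA]
    have h₁' : PowerSeries.coeff 1 (polynomialPowerSeriesSwap F A') = M * G := by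
      rw [hSA, sq, mul_assoc]
      simp
    have hCq : polynomialPowerSeriesSwap F (C (PowerSeries.C (4 * q))) =
        PowerSeries.C (C (4 * q)) := by
      rw [← polynomialPowerSeriesSwap_map_C, Polynomial.map_C]
    rw [map_sub, map_sub, map_pow, PowerSeries.coeff_one_pow, h₀, h₁', hCq, PowerSeries.coeff_C,
      if_neg one_ne_zero, sub_zero] at h₁
    have h₂ : π ^ (2 * m + 1) ∣ (π * t) ^ (e - 1) := by
      rw [mul_pow]
      exact (pow_dvd_pow π (by omega)).mul_right _
    have e₁ : ((2 : ℕ) : F[X]) * (M * G) * A ^ (2 - 1) = 2 * A * (M * G) := by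
      push_cast
      ring
    rw [e₁] at h₁
    exact h₂.trans h₁
  have h₄ := hπ.prime.pow_dvd_of_dvd_mul_left _ hπA hder
  have h₅ : π ^ (2 * m) * π ∣ π ^ (2 * m) * M₂ ^ 2 := by
    rw [← pow_succ]
    refine (h₄.trans (mul_dvd_mul_left M hGM)).trans ?_
    rw [hMm]
    exact ⟨1, by ring⟩
  exact hπM₂ (hπ.prime.dvd_of_dvd_pow
    ((mul_dvd_mul_iff_left (pow_ne_zero _ hπ.ne_zero)).1 h₅))

end Squarefree

/-! ### Rational functions on a variety -/

section FunctionField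

variable {ι : Type}

theorem exists_algHom_fractionRing (P : Ideal (MvPolynomial ι ℂ)) [P.IsPrime] {R : Type}
    [CommRing R] [Algebra ℂ R] (x : ι → R)
    (hx : P ≤ RingHom.ker (MvPolynomial.aeval (R := ℂ) x))
    (hu : ∀ h ∉ P, IsUnit (MvPolynomial.aeval (R := ℂ) x h)) :
    ∃ θ : FractionRing (MvPolynomial ι ℂ ⧸ P) →ₐ[ℂ] R, ∀ h,
      θ (algebraMap (MvPolynomial ι ℂ ⧸ P) _ (Ideal.Quotient.mk P h)) =
        MvPolynomial.aeval (R := ℂ) x h := by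
  let f : (MvPolynomial ι ℂ ⧸ P) →ₐ[ℂ] R := Ideal.Quotient.liftₐ P (MvPolynomial.aeval x) hx
  have hf : ∀ y : nonZeroDivisors (MvPolynomial ι ℂ ⧸ P), IsUnit (f y) := by
    rintro ⟨y, hy⟩
    obtain ⟨h, rfl⟩ := Ideal.Quotient.mk_surjective y
    refine hu h fun hP ↦ ?_
    exact nonZeroDivisors.ne_zero hy (Ideal.Quotient.eq_zero_iff_mem.2 hP)
  refine ⟨IsLocalization.liftAlgHom (M := nonZeroDivisors (MvPolynomial ι ℂ ⧸ P)) hf, fun h ↦ ?_⟩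
  rw [IsLocalization.liftAlgHom_apply, IsLocalization.lift_eq]
  rfl

end FunctionField

/-! ### Square-freeness of `Y` on a component -/

section Generic

variable {N d r : ℕ}

namespace SWData

/-- Specialization can only enlarge the ideal of a datum. Over a domain with `q ≠ 0` that ideal is a
prime containing the vanishing ideal of the solutions, so a datum specializing into a component
generically has the ideal of that component. -/
theorem ideal_eq_of_map {R R' : Type} [CommRing R] [CommRing R'] [Algebra ℂ R] [Algebra ℂ R']
    [IsDomain R] [Nontrivial R'] (hrN : r ≤ N) (hr : 1 ≤ r) (hrd : r ≤ d) (D : SWData N r R)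
    (θ : R →ₐ[ℂ] R') {I : Ideal (MvPolynomial (ChiralCoord N d) ℂ)}
    (hI : I ∈ (vanishingIdeal ℂ (chiralSet N d r)).minimalPrimes) (hq : D.q ≠ 0)
    (hle : (D.map (θ : R →+* R')).ideal d ≤ I) : D.ideal d = I := by
  have h₁ := (D.ideal_le_map (d := d) θ).trans hle
  exact le_antisymm h₁ (hI.2 ⟨inferInstance, D.vanishingIdeal_le_ideal hrN hr hrd hq⟩ h₁)

theorem ker_point {R : Type} [CommRing R] [Algebra ℂ R] [Nontrivial R] (D : SWData N r R) :
    RingHom.ker (MvPolynomial.aeval (R := ℂ) D.point) =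
      (D.ideal d).comap (MvPolynomial.rename Sum.inl).toRingHom := by
  ext h
  exact D.rename_mem_ideal_iff.symm

/-- At the generic point of a component of the chiral variety, `Y` is square-free. -/
theorem squarefree_Y {F : Type} [Field F] [Algebra ℂ F] (hrN : r ≤ N) (hr : 1 ≤ r) (hrd : r ≤ d)
    (D : SWData N r F) (hq : D.q ≠ 0)
    (hI : D.ideal d ∈ (vanishingIdeal ℂ (chiralSet N d r)).minimalPrimes) : Squarefree D.Y := by
  have : CharZero F := charZero_of_injective_algebraMap (algebraMap ℂ F).injective
  have hD := D.pair
  obtain ⟨G, hGM, A', M', Y', happ, heq, harc⟩ := exists_arc hr hrN hq hD.eq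
    (monic_charPoly _) (natDegree_charPoly _) hD.monic_left hD.natDegree_left
    hD.monic_right hD.natDegree_right
  obtain ⟨s', hs'⟩ := exists_charPoly_eq happ.monic₁ happ.natDegree₁
  dsimp only at hs'
  let x : SWCoord N → F⟦X⟧ := Sum.elim (fun _ ↦ PowerSeries.C D.q) s'
  have hx : IsSWPair r (x (Sum.inl ())) (fun k ↦ x (Sum.inr k)) M' Y' := by
    refine ⟨happ.monic₂, happ.natDegree₂, happ.monic₃, happ.natDegree₃, ?_⟩
    change charPoly s' ^ 2 - _ = _
    have h4 : PowerSeries.C (4 * D.q) = 4 * x (Sum.inl ()) := by rw [map_mul, map_ofNat]; rfl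
    rw [hs', ← heq, h4]
  obtain ⟨E, hEx, hEM, hEY⟩ := exists_of_pair hx
  let κ : F⟦X⟧ →ₐ[ℂ] F :=
    { (PowerSeries.constantCoeff : F⟦X⟧ →+* F) with
      commutes' := fun c ↦ by simp [IsScalarTower.algebraMap_apply ℂ F F⟦X⟧] }
  have hEpt : (fun i ↦ κ (E.point i)) = D.point := by
    rw [hEx]
    have hs : charPoly (fun k ↦ PowerSeries.constantCoeff (s' k)) = charPoly D.s := by
      rw [← map_charPoly, hs']; exact happ.map₁
    funext i
    rcases i with i | k
    · change PowerSeries.constantCoeff (PowerSeries.C D.q) = _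
      simp
    · exact congrFun (charPoly_injective hs) k
  have hED : E.map (κ : F⟦X⟧ →+* F) = D :=
    eq_of two_ne_zero hEpt (by rw [map_M, hEM]; exact happ.map₂)
      (by rw [map_Y, hEY]; exact happ.map₃)
  have hEq : E.q ≠ 0 := fun h0 ↦ hq <| by
    have h₁ : κ E.q = D.q := congrFun hEpt (Sum.inl ())
    rw [← h₁, h0, map_zero]
  -- The arc specializes to `D` at `ε = 0`, so by minimality it satisfies the same algebraic
  -- relations as `D`.
  have hideal := E.ideal_eq_of_map hrN hr hrd κ hI hEq (by rw [hED])
  have hker : RingHom.ker (MvPolynomial.aeval (R := ℂ) E.point) =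
      RingHom.ker (MvPolynomial.aeval (R := ℂ) D.point) := by
    rw [E.ker_point (d := d), D.ker_point (d := d), hideal]
  set P := RingHom.ker (MvPolynomial.aeval (R := ℂ) D.point) with hP
  have : P.IsPrime := RingHom.ker_isPrime _
  let K := FractionRing (MvPolynomial (SWCoord N) ℂ ⧸ P)
  -- A polynomial outside `P` has nonzero constant term along the arc, so the function field maps
  -- into `F⟦X⟧` and not just into its fraction field.
  obtain ⟨ψ, hψ⟩ := exists_algHom_fractionRing P E.point hker.ge (fun h hh ↦ by
    rw [PowerSeries.isUnit_iff_constantCoeff]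
    refine IsUnit.mk0 _ fun h0 ↦ hh ?_
    have : κ (MvPolynomial.aeval E.point h) = 0 := h0
    rw [MvPolynomial.comp_aeval_apply, hEpt] at this
    exact this)
  have : CharZero K := charZero_of_injective_algebraMap (algebraMap ℂ K).injective
  let y (i : SWCoord N) : K :=
    algebraMap (MvPolynomial (SWCoord N) ℂ ⧸ P) K (Ideal.Quotient.mk P (MvPolynomial.X i))
  have hy (i) : ψ (y i) = E.point i := (hψ _).trans (MvPolynomial.aeval_X _ _)
  let f : K[X] := charPoly (fun k ↦ y (Sum.inr k)) ^ 2 - C (4 * y (Sum.inl ()))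
  have hfψ : f.map (ψ : K →+* F⟦X⟧) = A' ^ 2 - C (PowerSeries.C (4 * D.q)) := by
    have h₁ : (fun k ↦ (ψ : K →+* F⟦X⟧) (y (Sum.inr k))) = s' := by
      funext k; exact (hy _).trans (congrFun hEx _)
    have h₂ : (ψ : K →+* F⟦X⟧) (4 * y (Sum.inl ())) = PowerSeries.C (4 * D.q) := by
      rw [map_mul, map_mul, map_ofNat, map_ofNat]
      exact congrArg (4 * ·) ((hy _).trans (congrFun hEx _))
    simp only [f, Polynomial.map_sub, Polynomial.map_pow, map_charPoly, h₁, hs', Polynomial.map_C,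
      h₂]
  refine squarefree_of_arc (ψ := (ψ : K →+* F⟦X⟧)) rfl hq hGM hD.monic_right.ne_zero
    hD.monic_left.ne_zero ?_ hD.eq hfψ harc
  rw [← Polynomial.map_map, hfψ]
  simp only [Polynomial.map_sub, Polynomial.map_pow, Polynomial.map_C, happ.map₁]
  simp

end SWData

end Generic

/-! ### Galois groups over a relatively algebraically closed extension -/

section Galois

/-- Restriction is injective because the roots of `f` generate the larger splitting field. An
element of the smaller one fixed by the image lies in `L` and is algebraic over `K`, hence in `K`;
so the image is everything by the Galois correspondence. -/
theorem sameGaloisGroup_map {K L : Type} [Field K] [Field L] [CharZero K] (φ : K →+* L)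
    (hφ : ∀ a : L, φ.IsIntegralElem a → a ∈ φ.range) (f : K[X]) :
    SameGaloisGroup φ f (f.map φ) := by
  let _ : Algebra K L := φ.toAlgebra
  have : CharZero L := charZero_of_injective_algebraMap φ.injective
  let S := f.SplittingField
  let E := (f.map φ).SplittingField
  have hsplit : (f.map (algebraMap K E)).Splits := by
    have := SplittingField.splits (f.map φ)
    rwa [Polynomial.map_map] at this
  let j : S →ₐ[K] E := SplittingField.lift f hsplit
  let _ : Algebra S E := j.toRingHom.toAlgebra
  have : IsScalarTower K S E := IsScalarTower.of_algebraMap_eq fun x ↦ (j.commutes x).symm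
  have : IsGalois L E := { }
  have : IsGalois K S := { }
  let ρ : Gal(E/L) →* Gal(S/K) := IntermediateField.restrictRestrictAlgEquivMapHom K S L E
  have hρ (τ : Gal(E/L)) (x : S) : τ (j x) = j (ρ τ x) :=
    (AlgEquiv.restrictNormal_commutes (MulSemiringAction.toAlgAut Gal(E/L) K E τ) S x).symm
  have hinj : Function.Injective ρ := by
    rw [injective_iff_map_eq_one]
    intro τ hτ
    refine Polynomial.Gal.ext (p := f.map φ) fun y hy ↦ ?_
    have hy' : y ∈ f.rootSet E := by
      rw [mem_rootSet'] at hy ⊢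
      refine ⟨?_, ?_⟩
      · have := hy.1; rwa [Polynomial.map_map] at this
      · have := hy.2
        rw [aeval_def, eval₂_map] at this
        exact this
    rw [← (SplittingField.splits f).image_rootSet j] at hy'
    obtain ⟨x, -, rfl⟩ := hy'
    have := hρ τ x
    rw [hτ] at this
    exact this
  have hsurj : Function.Surjective ρ := by
    suffices IntermediateField.fixedField ρ.range = ⊥ from
      MonoidHom.range_eq_top.mp <| IntermediateField.fixingSubgroup_fixedField ρ.range ▸
        this ▸ IntermediateField.fixingSubgroup_bot
    refine eq_bot_iff.2 fun x hx ↦ ?_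
    rw [IntermediateField.mem_fixedField_iff] at hx
    have hfix : j x ∈ (⊥ : IntermediateField L E) := by
      refine (IsGalois.mem_bot_iff_fixed _).2 fun τ ↦ ?_
      rw [hρ, hx _ ⟨τ, rfl⟩]
    obtain ⟨a, ha⟩ := IntermediateField.mem_bot.1 hfix
    have hint : IsIntegral K a := by
      have : IsIntegral K (algebraMap L E a) := by
        rw [ha]
        exact (Algebra.IsIntegral.isIntegral (R := K) x).map j
      exact (isIntegral_algebraMap_iff (algebraMap L E).injective).1 this
    obtain ⟨b, rfl⟩ := hφ a hint
    refine IntermediateField.mem_bot.2 ⟨b, j.toRingHom.injective ?_⟩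
    exact (j.commutes b).trans ha
  exact ⟨j.toRingHom, fun a ↦ j.commutes a, MulEquiv.ofBijective ρ ⟨hinj, hsurj⟩, hρ⟩

/-- Polynomial rings are integrally closed, so `a` is a polynomial `p`. The difference `p - p(0)` is
integral over `K`, so it would be a unit if nonzero, yet it vanishes at the origin. -/
theorem mem_range_of_isIntegral_fractionRing_mvPolynomial {K σ : Type} [Field K]
    (a : FractionRing (MvPolynomial σ K)) (ha : IsIntegral K a) :
    ∃ b : K, algebraMap K _ b = a := by
  obtain ⟨p, rfl⟩ := IsIntegrallyClosed.isIntegral_iff.1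
    (ha.tower_top (A := MvPolynomial σ K))
  have hp : IsIntegral K p :=
    (isIntegral_algebraMap_iff (IsFractionRing.injective (MvPolynomial σ K) _)).1 ha
  let ev : MvPolynomial σ K →ₐ[K] K := MvPolynomial.aeval 0
  have hp' : IsIntegral K (p - algebraMap K _ (ev p)) := hp.sub isIntegral_algebraMap
  have h0 : p - algebraMap K _ (ev p) = 0 := by
    by_contra hne
    have hu := (hp'.isUnit hne).map ev
    rw [map_sub, AlgHom.commutes] at hu
    simp at hu
  refine ⟨ev p, ?_⟩
  rw [IsScalarTower.algebraMap_apply K (MvPolynomial σ K), ← sub_eq_zero.1 h0]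

end Galois

/-! ### Square-free parts -/

section SquarefreePart

variable {K F : Type} [Field K] [Field F]

/-- After division by `gcd(A, M)²`, the square of the remaining factor of `A` divides `Y`, so that
factor is a unit. -/
theorem dvd_of_sq_dvd_sq_mul {A M Y : F[X]} (hA : A ≠ 0) (hY : Squarefree Y)
    (h : A ^ 2 ∣ M ^ 2 * Y) : A ∣ M := by
  obtain ⟨G, a, b, rfl, rfl, hco⟩ := exists_gcd_decomposition hA M
  have hG : G ≠ 0 := left_ne_zero_of_mul hA
  rw [mul_pow, mul_pow, mul_assoc, mul_dvd_mul_iff_left (pow_ne_zero 2 hG)] at h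
  have h₁ : a ^ 2 ∣ Y := (hco.pow (m := 2) (n := 2)).dvd_of_dvd_mul_left h
  have hu : IsUnit a := hY a (by rwa [← sq])
  exact mul_dvd_mul_left G hu.dvd

theorem factorization_unique {M M' Y Y' : F[X]} (hM : M.Monic) (hM' : M'.Monic)
    (hdeg : M.natDegree = M'.natDegree) (hY : Squarefree Y) (h : M ^ 2 * Y = M' ^ 2 * Y') :
    M = M' ∧ Y = Y' := by
  have hd : M' ∣ M := dvd_of_sq_dvd_sq_mul hM'.ne_zero hY ⟨Y', h⟩
  have e := eq_of_monic_of_dvd_of_natDegree_le hM' hM hd hdeg.le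
  subst e
  exact ⟨rfl, mul_left_cancel₀ (pow_ne_zero 2 hM.ne_zero) h⟩

theorem exists_sq_mul_squarefree {f : K[X]} (hf : f ≠ 0) :
    ∃ A B : K[X], f = A ^ 2 * B ∧ Squarefree B := by
  induction hn : f.natDegree using Nat.strong_induction_on generalizing f with
  | _ n ih =>
    by_cases hs : Squarefree f
    · exact ⟨1, f, by simp, hs⟩
    · obtain ⟨x, ⟨g, hg⟩, hx⟩ : ∃ x, x * x ∣ f ∧ ¬ IsUnit x := by
        simpa [Squarefree] using hs
      have hx0 : x ≠ 0 := by rintro rfl; simp at hg; exact hf hg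
      have hg0 : g ≠ 0 := by rintro rfl; simp at hg; exact hf hg
      have hxd : 0 < x.natDegree := natDegree_pos_iff_degree_pos.2 (degree_pos_of_ne_zero_of_nonunit hx0 hx)
      have hd : f.natDegree = x.natDegree + x.natDegree + g.natDegree := by
        rw [hg, natDegree_mul (mul_ne_zero hx0 hx0) hg0, natDegree_mul hx0 hx0]
      obtain ⟨A, B, rfl, hB⟩ := ih g.natDegree (by omega) hg0 rfl
      exact ⟨x * A, B, by rw [hg]; ring, hB⟩

/-- The square and square-free parts of a polynomial are defined over the field of definition. -/
theorem exists_descent [CharZero K] (φ : K →+* F) {f : K[X]} {M Y : F[X]} (hM : M.Monic)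
    (hY : Squarefree Y) (h : f.map φ = M ^ 2 * Y) :
    ∃ M' Y' : K[X], M'.map φ = M ∧ Y'.map φ = Y := by
  have hf : f ≠ 0 := by
    rintro rfl
    rw [Polynomial.map_zero] at h
    exact mul_ne_zero (pow_ne_zero 2 hM.ne_zero) hY.ne_zero h.symm
  obtain ⟨A, B, rfl, hB⟩ := exists_sq_mul_squarefree hf
  have hA : A ≠ 0 := by rintro rfl; simp at hf
  have hc : A.leadingCoeff ≠ 0 := leadingCoeff_ne_zero.2 hA
  -- In characteristic zero square-free means separable, which survives field extension.
  have hB' : Squarefree (B.map φ) := (PerfectField.separable_iff_squarefree.2 hB).map.squarefree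
  have hA₁ : (A * C A.leadingCoeff⁻¹).Monic := monic_mul_leadingCoeff_inv hA
  have hA₂ : C A.leadingCoeff * C A.leadingCoeff⁻¹ = 1 := by
    rw [← C_mul, mul_inv_cancel₀ hc, C_1]
  have hunit : IsUnit (C (φ A.leadingCoeff⁻¹)) :=
    isUnit_C.2 (IsUnit.mk0 _ ((map_ne_zero φ).2 (inv_ne_zero hc)))
  rw [Polynomial.map_mul, Polynomial.map_pow] at h
  have h₁ : A.map φ ∣ M := dvd_of_sq_dvd_sq_mul (map_ne_zero hA) hY ⟨_, h.symm⟩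
  have h₂ : M ∣ A.map φ := dvd_of_sq_dvd_sq_mul hM.ne_zero hB' ⟨_, h⟩
  have hMe : (A * C A.leadingCoeff⁻¹).map φ = M := by
    refine eq_of_monic_of_associated (hA₁.map φ) hM ?_
    rw [Polynomial.map_mul, Polynomial.map_C]
    exact (associated_mul_unit_left _ _ hunit).trans (associated_of_dvd_dvd h₁ h₂)
  refine ⟨A * C A.leadingCoeff⁻¹, C A.leadingCoeff ^ 2 * B, hMe,
    mul_left_cancel₀ (pow_ne_zero 2 hM.ne_zero) ?_⟩
  rw [← h]
  nth_rewrite 1 [← hMe]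
  rw [← Polynomial.map_pow, ← Polynomial.map_pow, ← Polynomial.map_mul, ← Polynomial.map_mul]
  congr 1
  linear_combination (A ^ 2 * B * (C A.leadingCoeff * C A.leadingCoeff⁻¹ + 1)) * hA₂

end SquarefreePart

/-! ### Maps out of the function field -/

namespace AffineVariety

variable {ι : Type} (V : AffineVariety ι)

theorem aeval_coord (h : MvPolynomial ι ℂ) :
    MvPolynomial.aeval V.coord h = algebraMap V.CoordinateRing V.FunctionField
      (Ideal.Quotient.mk (vanishingIdeal ℂ V.carrier) h) :=
  (MvPolynomial.comp_aeval_apply (φ := (IsScalarTower.toAlgHom ℂ V.CoordinateRing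
    V.FunctionField).comp (Ideal.Quotient.mkₐ ℂ _)) MvPolynomial.X h).symm.trans (by
      rw [MvPolynomial.aeval_X_left]; rfl)

theorem ker_aeval_coord :
    RingHom.ker (MvPolynomial.aeval (R := ℂ) V.coord) = vanishingIdeal ℂ V.carrier := by
  ext h
  rw [RingHom.mem_ker, aeval_coord, IsFractionRing.to_map_eq_zero_iff (R := V.CoordinateRing),
    Ideal.Quotient.eq_zero_iff_mem]

theorem exists_algHom_functionField {L : Type} [Field L] [Algebra ℂ L] (x : ι → L)
    (hx : RingHom.ker (MvPolynomial.aeval (R := ℂ) x) = vanishingIdeal ℂ V.carrier) :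
    ∃ θ : V.FunctionField →ₐ[ℂ] L, ∀ i, θ (V.coord i) = x i := by
  have := V.isPrime
  obtain ⟨θ, hθ⟩ := exists_algHom_fractionRing (vanishingIdeal ℂ V.carrier) x hx.ge
    fun h hh ↦ IsUnit.mk0 _ fun h0 ↦ hh (hx ▸ RingHom.mem_ker.2 h0)
  exact ⟨θ, fun i ↦ (hθ _).trans (MvPolynomial.aeval_X _ _)⟩

variable {V} in
theorem algHom_functionField_ext {L : Type} [CommRing L] [Algebra ℂ L]
    {θ θ' : V.FunctionField →ₐ[ℂ] L} (h : ∀ i, θ (V.coord i) = θ' (V.coord i)) : θ = θ' := by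
  refine IsLocalization.algHom_ext (nonZeroDivisors V.CoordinateRing) ?_
  refine Ideal.Quotient.algHom_ext _ (MvPolynomial.algHom_ext fun i ↦ h i)

theorem mem_carrier_iff {x : ι → ℂ} :
    x ∈ V.carrier ↔ ∀ h ∈ vanishingIdeal ℂ V.carrier, MvPolynomial.aeval x h = 0 := by
  conv_lhs => rw [← V.isClosed]
  rfl

end AffineVariety

theorem exists_algHom_of_isIntegral {R S Ω : Type} [CommRing R] [CommRing S] [Field Ω]
    [IsAlgClosed Ω] [Algebra ℂ R] [Algebra ℂ S] [Algebra ℂ Ω] [Algebra R S] [IsScalarTower ℂ R S]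
    [Algebra.IsIntegral R S] (θ : R →ₐ[ℂ] Ω)
    (hker : RingHom.ker (algebraMap R S) ≤ RingHom.ker (θ : R →+* Ω)) :
    ∃ η : S →ₐ[ℂ] Ω, ∀ a, η (algebraMap R S a) = θ a := by
  obtain ⟨η, hη⟩ := exists_extension_of_isIntegral (S := S) (θ : R →+* Ω) hker
  have hη' (a : R) : η (algebraMap R S a) = θ a := congrArg (fun ρ : R →+* Ω ↦ ρ a) hη
  refine ⟨{ η with commutes' := fun c ↦ ?_ }, hη'⟩
  have := hη' (algebraMap ℂ R c)
  rw [AlgHom.commutes, ← IsScalarTower.algebraMap_apply] at this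
  exact this

/-! ### The generic factorization and its projection -/

namespace SWData

variable {N d r : ℕ}

/-- A factorization over a field is defined over the integral closure of any ring that contains
the coordinates of the point. -/
theorem exists_integralClosure {R F : Type} [CommRing R] [Field F] [Algebra ℂ R] [Algebra ℂ F]
    [Algebra R F] [IsScalarTower ℂ R F] (hr : 1 ≤ r) (hrN : r ≤ N) (x : SWCoord N → R)
    (D : SWData N r F) (hx : ∀ i, D.point i = algebraMap R F (x i)) :
    ∃ E : SWData N r (integralClosure R F),
      E.map (algebraMap (integralClosure R F) F) = D ∧
        ∀ i, E.point i = algebraMap R (integralClosure R F) (x i) := by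
  have : CharZero F := charZero_of_injective_algebraMap (algebraMap ℂ F).injective
  have : Nontrivial R := (algebraMap R F).domain_nontrivial
  let f : R[X] := charPoly (fun k ↦ x (Sum.inr k)) ^ 2 - C (4 * x (Sum.inl ()))
  have hf : f.Monic := by
    refine ((monic_charPoly _).pow 2).sub_of_left (degree_C_le.trans_lt ?_)
    rw [degree_eq_natDegree ((monic_charPoly _).pow 2).ne_zero,
      (monic_charPoly _).natDegree_pow, natDegree_charPoly]
    exact Nat.cast_lt.2 (by omega : 0 < 2 * N)
  have hfD : f.map (algebraMap R F) = D.M ^ 2 * D.Y := by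
    rw [← D.pair.eq, Polynomial.map_sub, Polynomial.map_pow, map_charPoly, Polynomial.map_C,
      map_mul, map_ofNat]
    simp only [hx]
  -- Monic factors of a monic polynomial have integral coefficients.
  have lift {p : F[X]} (hp : p.Monic) (hpf : p ∣ f.map (algebraMap R F)) :
      ∃ p' : (integralClosure R F)[X], p'.map (algebraMap (integralClosure R F) F) = p :=
    (mem_lifts _).1 ((lifts_iff_coeff_lifts p).2 fun n ↦
      ⟨⟨p.coeff n, isIntegral_coeff_of_dvd f p hf hp hpf n⟩, rfl⟩)
  obtain ⟨M, hM⟩ := lift D.pair.monic_left (hfD ▸ (dvd_pow_self _ two_ne_zero).mul_right _)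
  obtain ⟨Y, hY⟩ := lift D.pair.monic_right (hfD ▸ dvd_mul_left _ _)
  let y : SWCoord N → integralClosure R F := fun i ↦ algebraMap R (integralClosure R F) (x i)
  have hy (i) : algebraMap (integralClosure R F) F (y i) = D.point i := (hx i).symm
  have hpair : IsSWPair r (y (Sum.inl ())) (fun k ↦ y (Sum.inr k)) M Y := by
    refine IsSWPair.of_map (θ := algebraMap (integralClosure R F) F) Subtype.val_injective ?_
    simp only [hy, hM, hY]
    exact D.pair
  obtain ⟨E, hEy, hEM, hEY⟩ := exists_of_pair hpair
  refine ⟨E, eq_of two_ne_zero ?_ ?_ ?_, fun i ↦ congrFun hEy i⟩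
  · funext i; rw [map_point, hEy, hy]
  · rw [map_M, hEM, hM]
  · rw [map_Y, hEY, hY]

theorem exists_integral_model {R F : Type} [CommRing R] [Field F] [Algebra ℂ R] [Algebra ℂ F]
    [Algebra R F] [IsScalarTower ℂ R F] (hr : 1 ≤ r) (hrN : r ≤ N) {x : SWCoord N → R}
    {D : SWData N r F} (hx : ∀ i, D.point i = algebraMap R F (x i)) (hq : D.q ≠ 0) :
    ∃ (S : Type) (_ : CommRing S) (_ : IsDomain S) (_ : Algebra ℂ S) (_ : Algebra R S)
      (_ : IsScalarTower ℂ R S) (_ : Algebra.IsIntegral R S) (j : S →ₐ[ℂ] F)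
      (E : SWData N r S), E.map (j : S →+* F) = D ∧
        (∀ i, E.point i = algebraMap R S (x i)) ∧
        (∀ a, j (algebraMap R S a) = algebraMap R F a) ∧ E.q ≠ 0 := by
  obtain ⟨E, hED, hEx⟩ := D.exists_integralClosure hr hrN x hx
  refine ⟨integralClosure R F, inferInstance, inferInstance, inferInstance, inferInstance,
    inferInstance, inferInstance, IsScalarTower.toAlgHom ℂ (integralClosure R F) F, E, hED, hEx,
    fun a ↦ rfl, fun h0 ↦ hq ?_⟩
  rw [← hED]
  change algebraMap (integralClosure R F) F E.q = 0
  rw [h0, map_zero]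

/-- The indeterminate couplings are specialized to `t_r = 1` and all others `0`; since `couplings`
preserves the entries of index at least `r`, the resulting point lies on the slice. -/
theorem projection_mem_of_ideal_eq {S : Type} [CommRing S] [Nontrivial S] [Algebra ℂ S] (E : SWData N r S)
    {M : AffineVariety (ChiralCoord N d)} (hE : E.ideal d = vanishingIdeal ℂ M.carrier)
    (η : S →ₐ[ℂ] ℂ) : (fun i ↦ η (E.point i)) ∈ projection '' (M.carrier ∩ slice N d r) := by
  let t : Fin (d + 1) → ℂ := fun k ↦ if k.val = r then 1 else 0
  refine ⟨(E.map (η : S →+* ℂ)).chiralPoint t,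
    ⟨M.mem_carrier_iff.2 fun p hp ↦ ?_, fun k ↦ ⟨fun hk ↦ ?_, fun hk ↦ ?_⟩⟩, rfl⟩
  · rw [← hE] at hp
    exact aeval_chiralPoint_eq_zero _ t (E.ideal_le_map η hp)
  · refine (couplings_of_le (E.map (η : S →+* ℂ)).sqrt.mul_eq t hk.ge).trans ?_
    simp [t, hk]
  · refine (couplings_of_le (E.map (η : S →+* ℂ)).sqrt.mul_eq t hk.le).trans ?_
    simp [t, hk.ne']

theorem eq_of_squarefree {F : Type} [Field F] [CharZero F] {D D' : SWData N r F}
    (h : D.point = D'.point) (hY : Squarefree D.Y) : D = D' := by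
  obtain ⟨hM, hY⟩ := factorization_unique D.pair.monic_left D'.pair.monic_left
    (D.pair.natDegree_left.trans D'.pair.natDegree_left.symm) hY (by
      rw [← D.pair.eq, ← D'.pair.eq, h])
  exact eq_of two_ne_zero h hM hY

/-- The generic point of a component of the chiral variety comes from a factorization and
independent couplings. -/
theorem exists_generic (hrN : r ≤ N) (hr : 1 ≤ r) (hrd : r ≤ d)
    {I : Ideal (MvPolynomial (ChiralCoord N d) ℂ)}
    (hI : I ∈ (vanishingIdeal ℂ (chiralSet N d r)).minimalPrimes) :
    ∃ (F : Type) (_ : Field F) (_ : Algebra ℂ F) (D : SWData N r F), D.q ≠ 0 ∧ D.ideal d = I := by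
  obtain ⟨F, _, _, x, M, Y, P, E, hker, hq, hg, h, h'⟩ := exists_generic_chiralPoint hrN hr hrd hI
  have : CharZero F := charZero_of_injective_algebraMap (algebraMap ℂ F).injective
  obtain ⟨D, hDx, -, rfl⟩ := exists_of_pair (x := fun i ↦ x (Sum.inl i)) h
  have hDq : D.q ≠ 0 := by rw [SWData.q, hDx]; exact hq
  refine ⟨F, inferInstance, inferInstance, D, hDq, ?_⟩
  have hpt : D.chiralPoint (fun k ↦ x (Sum.inr k)) = x := by
    have hc := couplings_eq_self two_ne_zero hrd h.monic_right h.natDegree_right D.sqrt h' hg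
    funext i
    rcases i with i | k
    · exact congrFun hDx i
    · exact congrFun hc k
  have hle : D.ideal d ≤ I := fun p hp ↦ by
    rw [← hker, RingHom.mem_ker, ← hpt]
    exact D.aeval_chiralPoint_eq_zero _ hp
  exact le_antisymm hle (hI.2 ⟨inferInstance, D.vanishingIdeal_le_ideal hrN hr hrd hDq⟩ hle)

/-- `V` is the closure of the generic point `(q, σ)`. As `Y` is square-free, `M` and `Y` are
determined by `C² - 4q` and descend to `ℂ(V)` (`exists_descent`); minimality keeps the ideal
unchanged. -/
theorem exists_functionField (hrN : r ≤ N) (hr : 1 ≤ r) (hrd : r ≤ d)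
    {I : Ideal (MvPolynomial (ChiralCoord N d) ℂ)}
    (hI : I ∈ (vanishingIdeal ℂ (chiralSet N d r)).minimalPrimes) :
    ∃ (V : AffineVariety (SWCoord N)) (D : SWData N r V.FunctionField),
      D.point = V.coord ∧ D.q ≠ 0 ∧ D.ideal d = I := by
  obtain ⟨F, _, _, D, hq, rfl⟩ := exists_generic hrN hr hrd hI
  have hY := D.squarefree_Y hrN hr hrd hq hI
  have : CharZero F := charZero_of_injective_algebraMap (algebraMap ℂ F).injective
  have : (RingHom.ker (MvPolynomial.aeval (R := ℂ) D.point)).IsPrime := RingHom.ker_isPrime _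
  let V := AffineVariety.ofPrime (RingHom.ker (MvPolynomial.aeval (R := ℂ) D.point))
  have hV : RingHom.ker (MvPolynomial.aeval (R := ℂ) D.point) = vanishingIdeal ℂ V.carrier :=
    (MvPolynomial.IsPrime.vanishingIdeal_zeroLocus _).symm
  obtain ⟨θ, hθ⟩ := V.exists_algHom_functionField D.point hV
  have : CharZero V.FunctionField :=
    charZero_of_injective_algebraMap (algebraMap ℂ V.FunctionField).injective
  let f : V.FunctionField[X] :=
    charPoly (fun k ↦ V.coord (Sum.inr k)) ^ 2 - C (4 * V.coord (Sum.inl ()))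
  have hf : f.map (θ : V.FunctionField →+* F) = D.M ^ 2 * D.Y := by
    rw [← D.pair.eq, Polynomial.map_sub, Polynomial.map_pow, map_charPoly, Polynomial.map_C,
      map_mul, map_ofNat]
    simp only [RingHom.coe_coe, hθ]
  obtain ⟨M, Y, hM, hY'⟩ := exists_descent (θ : V.FunctionField →+* F) D.pair.monic_left hY hf
  have hpair : IsSWPair r (V.coord (Sum.inl ())) (fun k ↦ V.coord (Sum.inr k)) M Y := by
    refine IsSWPair.of_map (θ := (θ : V.FunctionField →+* F)) (RingHom.injective _) ?_
    simp only [RingHom.coe_coe, hθ, hM, hY']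
    exact D.pair
  obtain ⟨E, hEx, hEM, hEY⟩ := exists_of_pair hpair
  have hmap : E.map (θ : V.FunctionField →+* F) = D := by
    refine eq_of two_ne_zero ?_ ?_ ?_
    · funext i; rw [map_point, hEx]; exact hθ i
    · rw [map_M, hEM, hM]
    · rw [map_Y, hEY, hY']
  have hEq : E.q ≠ 0 := by
    intro h0
    apply hq
    rw [← hmap]
    change θ E.q = 0
    rw [h0, map_zero]
  exact ⟨V, E, hEx, hEq, E.ideal_eq_of_map hrN hr hrd θ hI hEq (by rw [hmap])⟩

variable {M : AffineVariety (ChiralCoord N d)} {V : AffineVariety (SWCoord N)}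
  {D : SWData N r V.FunctionField}

theorem rename_mem_vanishingIdeal_iff (hD : D.point = V.coord)
    (hI : D.ideal d = vanishingIdeal ℂ M.carrier) {h : MvPolynomial (SWCoord N) ℂ} :
    MvPolynomial.rename Sum.inl h ∈ vanishingIdeal ℂ M.carrier ↔
      h ∈ vanishingIdeal ℂ V.carrier := by
  rw [← hI, rename_mem_ideal_iff, hD]
  exact RingHom.mem_ker.symm.trans (SetLike.ext_iff.1 V.ker_aeval_coord h)

/-- The image is closed because the factorization lives over an integral extension of `ℂ[V]`: by
lying over, every complex point of `V`, even one with `q = 0`, extends to it and thus lifts to the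
slice. -/
theorem carrier_eq_projection_image (hrN : r ≤ N) (hr : 1 ≤ r) (hrd : r ≤ d)
    (hD : D.point = V.coord) (hI : D.ideal d = vanishingIdeal ℂ M.carrier) (hq : D.q ≠ 0)
    (hM : vanishingIdeal ℂ M.carrier ∈ (vanishingIdeal ℂ (chiralSet N d r)).minimalPrimes) :
    V.carrier = projection '' (M.carrier ∩ slice N d r) := by
  apply Set.Subset.antisymm
  · intro x hx
    obtain ⟨S, _, _, _, _, _, _, j, E, hED, hEx, hj, hEq⟩ := exists_integral_model hr hrN
      (R := V.CoordinateRing)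
      (x := fun i ↦ Ideal.Quotient.mk (vanishingIdeal ℂ V.carrier) (MvPolynomial.X i))
      (fun i ↦ congrFun hD i) hq
    have hEI := E.ideal_eq_of_map hrN hr hrd j hM hEq (by rw [← hI, hED])
    let θ : V.CoordinateRing →ₐ[ℂ] ℂ :=
      Ideal.Quotient.liftₐ _ (MvPolynomial.aeval x) fun h hh ↦ (V.mem_carrier_iff.1 hx) h hh
    obtain ⟨η, hη⟩ := exists_algHom_of_isIntegral (S := S) θ fun a ha ↦ by
      have h0 : algebraMap V.CoordinateRing V.FunctionField a = 0 := by
        rw [← hj, RingHom.mem_ker.1 ha, map_zero]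
      rw [(IsFractionRing.to_map_eq_zero_iff (R := V.CoordinateRing)).1 h0]
      exact zero_mem _
    have hx' : (fun i ↦ η (E.point i)) = x := by
      funext i
      rw [hEx, hη]
      exact MvPolynomial.aeval_X x i
    rw [← hx']
    exact E.projection_mem_of_ideal_eq hEI η
  · rintro _ ⟨x, ⟨hx, -⟩, rfl⟩
    refine V.mem_carrier_iff.2 fun h hh ↦ ?_
    have := M.mem_carrier_iff.1 hx _ ((rename_mem_vanishingIdeal_iff hD hI).2 hh)
    rwa [MvPolynomial.aeval_rename] at this

/-- Let `P` be the prime of a component of `𝒩_r` containing `V`. Its generic factorization, taken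
over an integral extension, specializes to the generic point of `V`, where it must be the given one
by uniqueness. Minimality of the prime of `M` then gives both data the same ideal, so `P` is the
ideal of `V`. -/
theorem isComponentOf_swVariety (hrN : r ≤ N) (hr : 1 ≤ r) (hrd : r ≤ d)
    (hD : D.point = V.coord) (hI : D.ideal d = vanishingIdeal ℂ M.carrier) (hq : D.q ≠ 0)
    (hM : vanishingIdeal ℂ M.carrier ∈ (vanishingIdeal ℂ (chiralSet N d r)).minimalPrimes) :
    V.IsComponentOf (swVariety N r) := by
  change V.IsComponentOf (zariskiClosure (swSet N r))
  rw [V.isComponentOf_zariskiClosure_iff, ← V.ker_aeval_coord]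
  have hSV : vanishingIdeal ℂ (swSet N r) ≤ RingHom.ker (MvPolynomial.aeval (R := ℂ) V.coord) :=
    vanishingIdeal_swSet_le_ker hrN hr (hD ▸ hq) (hD ▸ D.pair)
  have hprime : (RingHom.ker (MvPolynomial.aeval (R := ℂ) V.coord)).IsPrime :=
    RingHom.ker_isPrime _
  obtain ⟨P, hP, hPV⟩ := Ideal.exists_minimalPrimes_le hSV
  suffices h : RingHom.ker (MvPolynomial.aeval (R := ℂ) V.coord) ≤ P by
    rwa [le_antisymm h hPV]
  obtain ⟨F, _, _, x, A, Y, hker, hx, h⟩ := exists_generic_swPoint hrN hr hP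
  obtain ⟨D₁, rfl, -, -⟩ := exists_of_pair h
  let _ : Algebra (MvPolynomial (SWCoord N) ℂ) F := (MvPolynomial.aeval D₁.point).toAlgebra
  have : IsScalarTower ℂ (MvPolynomial (SWCoord N) ℂ) F :=
    IsScalarTower.of_algebraMap_eq fun c ↦ ((MvPolynomial.aeval D₁.point).commutes c).symm
  have halg (p : MvPolynomial (SWCoord N) ℂ) :
      algebraMap (MvPolynomial (SWCoord N) ℂ) F p = MvPolynomial.aeval D₁.point p := rfl
  obtain ⟨S, _, _, _, _, _, _, j, E, hED, hEx, hSF, hEq⟩ := exists_integral_model hr hrN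
    (R := MvPolynomial (SWCoord N) ℂ) (x := fun i ↦ MvPolynomial.X i) (D := D₁)
    (fun i ↦ by rw [halg, MvPolynomial.aeval_X]) hx
  simp only [halg] at hSF
  let Ω := AlgebraicClosure V.FunctionField
  let κ : V.FunctionField →ₐ[ℂ] Ω := IsScalarTower.toAlgHom ℂ V.FunctionField Ω
  have : CharZero V.FunctionField :=
    charZero_of_injective_algebraMap (algebraMap ℂ V.FunctionField).injective
  have : CharZero Ω := charZero_of_injective_algebraMap (algebraMap ℂ Ω).injective
  let θ : MvPolynomial (SWCoord N) ℂ →ₐ[ℂ] Ω := κ.comp (MvPolynomial.aeval V.coord)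
  obtain ⟨η, hη⟩ := exists_algHom_of_isIntegral (S := S) θ fun p hp ↦ by
    have h₁ : p ∈ P := by
      rw [← hker, RingHom.mem_ker, ← hSF, RingHom.mem_ker.1 hp, map_zero]
    have h₂ := RingHom.mem_ker.1 (hPV h₁)
    rw [RingHom.mem_ker]
    change κ (MvPolynomial.aeval V.coord p) = 0
    rw [h₂, map_zero]
  have hYsq : Squarefree (D.map (κ : V.FunctionField →+* Ω)).Y := by
    have := D.squarefree_Y hrN hr hrd hq (hI ▸ hM)
    exact (PerfectField.separable_iff_squarefree.2 this).map.squarefree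
  -- Lying over controls only `(q, σ)`; square-freeness of `Y` is what forces the factors to agree
  -- as well.
  have hmap : D.map (κ : V.FunctionField →+* Ω) = E.map (η : S →+* Ω) := by
    refine eq_of_squarefree ?_ hYsq
    funext i
    rw [map_point, map_point, hD, hEx]
    change _ = η (algebraMap _ _ (MvPolynomial.X i))
    rw [hη]
    exact congrArg κ (MvPolynomial.aeval_X _ _).symm
  have hEI : E.ideal d = D.ideal d := by
    rw [← hI] at hM
    refine E.ideal_eq_of_map hrN hr hrd η hM hEq ?_
    rw [← hmap]
    exact D.ideal_map_le_of_injective κ κ.toRingHom.injective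
  intro p hp
  rw [← hD, D.ker_point (d := d), ← hEI, ← E.ker_point, RingHom.mem_ker] at hp
  have hpt : MvPolynomial.aeval E.point p = algebraMap _ S p := by
    have : E.point = fun i ↦ algebraMap (MvPolynomial (SWCoord N) ℂ) S (MvPolynomial.X i) :=
      _root_.funext hEx
    rw [this]
    refine (MvPolynomial.comp_aeval_apply (φ := IsScalarTower.toAlgHom ℂ
      (MvPolynomial (SWCoord N) ℂ) S) MvPolynomial.X p).symm.trans ?_
    rw [MvPolynomial.aeval_X_left]
    rfl
  rw [← hker, RingHom.mem_ker, ← hSF, ← hpt, hp, map_zero]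

/-- The generic point embeds `ℂ(M)` into `ℂ(V)(t_0, …, t_d)` compatibly with `ℂ(V)`, and a purely
transcendental extension contains no new algebraic elements. -/
theorem exists_embedding (hD : D.point = V.coord)
    (hI : D.ideal d = vanishingIdeal ℂ M.carrier) :
    ∃ φ : V.FunctionField →ₐ[ℂ] M.FunctionField,
      (∀ i, φ (V.coord i) = M.coord (Sum.inl i)) ∧
      ∀ a : M.FunctionField, (φ : V.FunctionField →+* M.FunctionField).IsIntegralElem a →
        a ∈ (φ : V.FunctionField →+* M.FunctionField).range := by
  have hker : RingHom.ker (MvPolynomial.aeval (R := ℂ) fun i ↦ M.coord (Sum.inl i)) =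
      vanishingIdeal ℂ V.carrier := by
    ext h
    rw [← rename_mem_vanishingIdeal_iff hD hI, RingHom.mem_ker]
    refine Iff.trans ?_ (SetLike.ext_iff.1 M.ker_aeval_coord _)
    rw [RingHom.mem_ker, MvPolynomial.aeval_rename]
    rfl
  obtain ⟨φ, hφ⟩ := V.exists_algHom_functionField _ hker
  let T := MvPolynomial (Fin (d + 1)) V.FunctionField
  let L := FractionRing T
  have hker' : RingHom.ker (MvPolynomial.aeval (R := ℂ)
      fun i ↦ algebraMap T L (D.genericPoint d i)) = vanishingIdeal ℂ M.carrier := by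
    rw [← hI]
    ext h
    rw [RingHom.mem_ker, ideal, RingHom.mem_ker]
    have := MvPolynomial.comp_aeval_apply (φ := IsScalarTower.toAlgHom ℂ T L)
      (D.genericPoint d) h
    refine (Eq.congr_left this.symm).trans ?_
    exact IsFractionRing.to_map_eq_zero_iff (R := T) (K := L)
  obtain ⟨β, hβ⟩ := M.exists_algHom_functionField _ hker'
  have hβφ : β.comp φ = IsScalarTower.toAlgHom ℂ V.FunctionField L := by
    refine AffineVariety.algHom_functionField_ext fun i ↦ ?_
    rw [AlgHom.comp_apply, hφ, hβ]
    change algebraMap T L (MvPolynomial.C (D.point i)) = _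
    rw [hD]
    exact (IsScalarTower.algebraMap_apply V.FunctionField T L _).symm
  have hβφ' (b : V.FunctionField) : β (φ b) = algebraMap V.FunctionField L b :=
    congrArg (fun ρ : V.FunctionField →ₐ[ℂ] L ↦ ρ b) hβφ
  refine ⟨φ, hφ, ?_⟩
  rintro a ⟨p, hp, hpa⟩
  have hint : IsIntegral V.FunctionField (β a) := by
    refine ⟨p, hp, ?_⟩
    have h₁ := congrArg β hpa
    rw [map_zero] at h₁
    have h₂ := Polynomial.hom_eval₂ p (φ : V.FunctionField →+* M.FunctionField)
      (β : M.FunctionField →+* L) a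
    have h₃ : (β : M.FunctionField →+* L).comp (φ : V.FunctionField →+* M.FunctionField) =
        algebraMap V.FunctionField L := RingHom.ext hβφ'
    rw [h₃] at h₂
    exact h₂.symm.trans h₁
  obtain ⟨b, hb⟩ := mem_range_of_isIntegral_fractionRing_mvPolynomial _ hint
  exact ⟨b, β.toRingHom.injective ((hβφ' b).trans hb)⟩

end SWData

end GaugePhase

end

theorem mainTheorem2 (N d r : ℕ) (hr : 1 ≤ r) (hrN : r ≤ N) (hrd : r ≤ d)
    (M : GaugePhase.AffineVariety (GaugePhase.ChiralCoord N d))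
    (hM : M.IsComponentOf (GaugePhase.chiralVariety N d r)) :
    ∃ V : GaugePhase.AffineVariety (GaugePhase.SWCoord N),
      V.carrier = GaugePhase.projection '' (M.carrier ∩ GaugePhase.slice N d r) ∧
      V.IsComponentOf (GaugePhase.swVariety N r) ∧
      ∃ φ : V.FunctionField →ₐ[ℂ] M.FunctionField,
        (∀ i : GaugePhase.SWCoord N, φ (V.coord i) = M.coord (Sum.inl i)) ∧
        GaugePhase.SameGaloisGroup (φ : V.FunctionField →+* M.FunctionField)
          (GaugePhase.charPoly fun k : Fin N => V.coord (Sum.inr k))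
          (GaugePhase.charPoly fun k : Fin N => M.coord (Sum.inl (Sum.inr k))) := by
  have hI := (M.isComponentOf_zariskiClosure_iff (GaugePhase.chiralSet N d r)).1 hM
  obtain ⟨V, D, hD, hq, hDI⟩ := GaugePhase.SWData.exists_functionField hrN hr hrd hI
  obtain ⟨φ, hφ, hclosed⟩ := GaugePhase.SWData.exists_embedding hD hDI
  refine ⟨V, GaugePhase.SWData.carrier_eq_projection_image hrN hr hrd hD hDI hq hI,
    GaugePhase.SWData.isComponentOf_swVariety hrN hr hrd hD hDI hq hI, φ, hφ, ?_⟩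
  have : CharZero V.FunctionField :=
    charZero_of_injective_algebraMap (algebraMap ℂ V.FunctionField).injective
  have e : (GaugePhase.charPoly fun k : Fin N => V.coord (Sum.inr k)).map
      (φ : V.FunctionField →+* M.FunctionField) =
        GaugePhase.charPoly fun k : Fin N => M.coord (Sum.inl (Sum.inr k)) := by
    rw [GaugePhase.map_charPoly]
    simp only [RingHom.coe_coe, hφ]
  rw [← e]
  exact GaugePhase.sameGaloisGroup_map _ hclosed _
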